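/- **Setting.** Let $k$ be a field and let $\hat S$ be an elementary $k$-algebra with enough idempotents $\{e_u\}_{u\in\hat{\mathcal P}}$, i.e. an associative $k$-algebra (possibly without unit) with non-zero pairwise orthogonal idempotents $e_u$ such that $\bigoplus_u e_u\hat S=\hat S=\bigoplus_u\hat Se_u$, $e_u\hat Se_u=ke_u$, and $e_v\hat Se_u=0$ for $u\neq v$. A *$b$-algebra* over $\hat S$ is a graded unitary $\hat S$-$\hat S$-bimodule $\hat Z$ (with central action of $k$) equipped with homogeneous bimodule morphisms $\hat b_n:\hat Z^{\otimes_{\hat S} n}\to\hat Z$ of degree $1$, $n\ge1$, such that $\sum_{r+s+t=n,\,s\ge1}\hat b_{r+1+t}(\mathrm{id}^{\otimes r}\otimes\hat b_s\otimes \mathrm{id}^{\otimes t})=0$ for all $n\geq 1$ (Koszul signs). It is *unitary strict* if there are non-zero elements $\mathfrak e_u\in e_u\hat Z_{-1}e_u$ with $\hat b_2(\mathfrak e_u\otimes a)=e_ua$ and $\hat b_2(a\otimes\mathfrak e_u)=(-1)^{|a|+1}ae_u$ for homogeneous $a$, and such that, for $n\ne2$, $\hat b_n$ vanishes on every composable sequence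 of directed elements (elements of some $e_v\hat Ze_u$) containing some $\mathfrak e_u$. It is a *$(b,\nu)$-algebra* if there are an automorphism $\nu$ of $\hat S$ of infinite order, permuting the $e_u$ with $\nu^t(e_u)\ne e_u$ for $t\neq0$, and commuting left and right actions of $\langle\nu\rangle$ on $\hat Z$ by linear automorphisms of degree $-1$, with $\nu(e_ua)=\nu(e_u)\nu a$, $\nu(ae_u)=(\nu a)e_u$, $(ae_u)\nu=(a\nu)\nu^{-1}(e_u)$, $(e_ua)\nu=e_u(a\nu)$, such that for some set $\mathcal P$ of representatives of the $\langle\nu\rangle$-orbits in $\hat{\mathcal P}$, with $\hat Z_{s,t}=\bigoplus_{v\in\nu^s\mathcal P,\,u\in\nu^t\mathcal P}e_v\hat Ze_u$ and $\rho_{s,t}:\hat Z_{s,t}\to\hat Z_{0,0}$, $a\mapsto\nu^{-s}a\nu^t$, one has on $\hat Z_{s_0,s_1}\otimes\cdots\otimes\hat Z_{s_{n-1},s_n}$ $$\hat b_n=(-1)^{s_0-s_n}\rho_{s_0,s_n}^{-1}\,\hat b_n\,(\rho_{s_0,s_1}\otimes\cdots\otimes\rho_{s_{n-1},s_n}).$$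 For unitary right $\hat S$-modules $X,Y$ with finite support (i.e. $Xe_u=0$ for almost all $u$) put $\mathrm{ad}(\hat Z)(X,Y)=\bigoplus_{u,v}\mathrm{Hom}_k(Xe_u,Ye_v)\otimes_k e_v\hat Ze_u$, graded by $\hat Z$, and $\hat b^{ad}_n\big((f_n\otimes a_n)\otimes\cdots\otimes(f_1\otimes a_1)\big)=f_n\cdots f_1\otimes\hat b_n(a_n\otimes\cdots\otimes a_1)$. The objects of $\mathcal Z(\hat Z)$ are the pairs $(X,\delta_X)$ with $X$ as above and $\delta_X=\sum_x f_x\otimes x\in\mathrm{ad}(\hat Z)(X,X)_0$ (the $x$ running through a basis of $\hat Z$) such that there is a finite filtration $0=X_0\subseteq\cdots\subseteq X_\ell=X$ by submodules with $f_x(X_r)\subseteq X_{r-1}$ for all $x$ and all $r\ge1$, and $\sum_{s\ge1}\hat b_s^{ad}(\delta_X^{\otimes s})=0$. The morphisms $(X,\delta_X)\to(Y,\delta_Y)$ are the $f\in\mathrm{ad}(\hat Z)(X,Y)_{-1}$ with $\sum_{i_0,i_1\geq 0}\hat b^{ad}_{i_0+i_1+1}(\delta_Y^{\otimes i_1}\otimes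 f\otimes\delta_X^{\otimes i_0})=0$; the composition is $$g\star f=\sum_{i_0,i_1,i_2\ge0}\hat b^{ad}_{i_0+i_1+i_2+2}(\delta_W^{\otimes i_2}\otimes g\otimes\delta_Y^{\otimes i_1}\otimes f\otimes\delta_X^{\otimes i_0}),$$ which need not be associative, and the identity of $(X,\delta_X)$ is $\sum_u\mathrm{id}_{Xe_u}\otimes\mathfrak e_u$. A morphism of $\mathcal Z(\hat Z)$ is *special* if it has the form $\sum_u f_u\otimes\mathfrak e_u$ with linear maps $f_u:Xe_u\to Ye_u$. A *special conflation* is a pair of special morphisms $(X,\delta_X)\xrightarrow{f}(E,\delta_E)\xrightarrow{g}(Y,\delta_Y)$ of $\mathcal Z(\hat Z)$ such that $0\to Xe_u\xrightarrow{f_u}Ee_u\xrightarrow{g_u}Ye_u\to0$ is exact for every $u$; then $f$ is called a *special inflation* and $g$ a *special deflation*. **Proposition.** Let $\hat Z$ be a unitary strict $(b,\nu)$-algebra over $\hat S$. Then, in $\mathcal Z(\hat Z)$: 1. If $(X,\delta_X)\xrightarrow{f}(E,\delta_E)\xrightarrow{g}(Y,\delta_Y)$ is a special conflation, then $f$ is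 a kernel of $g$ and $g$ is a cokernel of $f$: $g\star f=0$; every morphism $h$ into $(E,\delta_E)$ with $g\star h=0$ is $h=f\star h'$ for a unique morphism $h'$; and every morphism $h$ out of $(E,\delta_E)$ with $h\star f=0$ is $h=h'\star g$ for a unique morphism $h'$. 2. The composition of two composable special inflations is a special inflation, and the composition of two composable special deflations is a special deflation. 3. For each special inflation $f:(X,\delta_X)\to(E,\delta_E)$ and each morphism $h:(X,\delta_X)\to(X',\delta_{X'})$ there are a special inflation $f':(X',\delta_{X'})\to(E',\delta_{E'})$ and a morphism $h':(E,\delta_E)\to(E',\delta_{E'})$ such that $h'\star f=f'\star h$. 4. For each special deflation $g:(E,\delta_E)\to(Y,\delta_Y)$ and each morphism $h:(Y',\delta_{Y'})\to(Y,\delta_Y)$ there are a special deflation $g':(E',\delta_{E'})\to(Y',\delta_{Y'})$ and a morphism $h':(E',\delta_{E'})\to(E,\delta_E)$ such that $g\star h'=h\star g'$. 5. Identity morphisms are special inflations and special deflations. Moreover, if $f$ and $g$ are special composable morphisms and $g\star f$ is a special inflation (resp. a special deflation), then $f$ is a special inflation (resp. $g$ is a special deflation). -/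

import Mathlib

open scoped TensorProduct

universe uk uS uP uZ uX

noncomputable section

namespace SpecialConflations

/-! ### Elementary algebras with enough idempotents -/

/-- `S` (an associative `k`-algebra, possibly without unit), with the distinguished family `e`
of pairwise orthogonal primitive idempotents, is an elementary `k`-algebra with enough
idempotents: `⊕ e_u S = S = ⊕ S e_u`, `e_u S e_u = k e_u`, and `e_v S e_u = 0` for `u ≠ v`.
The two sums are automatically direct because the `e_u` are orthogonal, and a nonzero `e_u` is
automatically primitive because `e_u S e_u = k e_u`. -/
structure IsElementary (k : Type uk) {S : Type uS} {P : Type uP} [Field k] [NonUnitalRing S]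
    [Module k S] [IsScalarTower k S S] [SMulCommClass k S S] (e : P → S) : Prop where
  ne_zero : ∀ u, e u ≠ 0
  idem : ∀ u, e u * e u = e u
  orth : ∀ u v, u ≠ v → e u * e v = 0
  left_top : ⨆ u, LinearMap.range (LinearMap.mulLeft k (e u)) = ⊤
  right_top : ⨆ u, LinearMap.range (LinearMap.mulRight k (e u)) = ⊤
  diag : ∀ u s, ∃ c : k, e u * s * e u = c • e u
  offdiag : ∀ u v, u ≠ v → ∀ s, e v * s * e u = 0

/-! ### Graded bimodules -/

/-- A graded unitary `S`-`S`-bimodule with central action of `k`.  `lact s a` is `s a` and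
`ract s a` is `a s`; the algebra `S` is concentrated in degree `0`. -/
structure GradedBimodule (k : Type uk) {S : Type uS} {P : Type uP} [Field k] [NonUnitalRing S]
    [Module k S] (e : P → S) where
  carrier : Type uZ
  [addCommGroup : AddCommGroup carrier]
  [module : Module k carrier]
  lact : S →ₗ[k] carrier →ₗ[k] carrier
  ract : S →ₗ[k] carrier →ₗ[k] carrier
  lact_mul : ∀ s t a, lact (s * t) a = lact s (lact t a)
  ract_mul : ∀ s t a, ract (s * t) a = ract t (ract s a)
  lact_ract : ∀ s t a, lact s (ract t a) = ract t (lact s a)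
  left_top : ⨆ u, LinearMap.range (lact (e u)) = ⊤
  right_top : ⨆ u, LinearMap.range (ract (e u)) = ⊤
  deg : ℤ → Submodule k carrier
  deg_internal : DirectSum.IsInternal deg
  lact_deg : ∀ s q, ∀ a ∈ deg q, lact s a ∈ deg q
  ract_deg : ∀ s q, ∀ a ∈ deg q, ract s a ∈ deg q

attribute [instance] GradedBimodule.addCommGroup GradedBimodule.module

section Algebra

variable {k : Type uk} {S : Type uS} {P : Type uP} [Field k] [NonUnitalRing S]
  [Module k S] {e : P → S}

/-- The subspace `e_v Z e_u` of a bimodule `Z`. -/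
def GradedBimodule.dir (M : GradedBimodule.{uk, uS, uP, uZ} k e) (v u : P) :
    Submodule k M.carrier :=
  LinearMap.range (M.lact (e v) ∘ₗ M.ract (e u))

/-! ### `b`-algebras -/

variable (k e) in
/-- A `b`-algebra over `S`: a graded unitary `S`-`S`-bimodule `Z` with homogeneous morphisms of
bimodules `b_n : Z ⊗_S ⋯ ⊗_S Z → Z` (`n ≥ 1`) of degree `1`, subject to
`∑_{r+s+t=n} b_{r+1+t} (id^{⊗ r} ⊗ b_s ⊗ id^{⊗ t}) = 0` (with the Koszul sign convention).
A morphism of bimodules on the `n`-fold tensor product over `S` is written as a `k`-multilinear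
map of `n` arguments that is `S`-balanced in the interior (`b_balanced`) and `S`-linear at the
two ends (`b_left`, `b_right`).  The value of `b` at `0` is never used. -/
structure BAlgebra extends GradedBimodule.{uk, uS, uP, uZ} k e where
  b : ∀ n : ℕ, MultilinearMap k (fun _ : Fin n => carrier) carrier
  b_left : ∀ (n : ℕ) (a : Fin (n + 1) → carrier) (s : S),
    b (n + 1) (Function.update a 0 (lact s (a 0))) = lact s (b (n + 1) a)
  b_right : ∀ (n : ℕ) (a : Fin (n + 1) → carrier) (s : S),
    b (n + 1) (Function.update a (Fin.last n) (ract s (a (Fin.last n)))) = ract s (b (n + 1) a)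
  b_balanced : ∀ (n : ℕ) (a : Fin (n + 1) → carrier) (s : S) (i : Fin n),
    b (n + 1) (Function.update a i.castSucc (ract s (a i.castSucc)))
      = b (n + 1) (Function.update a i.succ (lact s (a i.succ)))
  b_deg : ∀ n : ℕ, 1 ≤ n → ∀ (d : Fin n → ℤ) (a : Fin n → carrier),
    (∀ i, a i ∈ deg (d i)) → b n a ∈ deg ((∑ i, d i) + 1)
  b_rel : ∀ n : ℕ, 1 ≤ n → ∀ (d : ℕ → ℤ) (a : ℕ → carrier), (∀ i, a i ∈ deg (d i)) →
    ∑ r ∈ Finset.range n, ∑ s ∈ Finset.Icc 1 (n - r),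
      (∑ i ∈ Finset.range r, d i).negOnePow •
        b (r + 1 + (n - r - s)) (fun i =>
          if (i : ℕ) < r then a i
          else if (i : ℕ) = r then b s (fun j => a (r + j))
          else a (i + s - 1)) = 0

/-- A directed element `x` (some `x = e_v x e_u`) is strict if `b_n`, for every `n ≠ 2`,
vanishes on each composable sequence of directed elements in which `x` occurs. -/
def BAlgebra.IsStrict (B : BAlgebra.{uk, uS, uP, uZ} k e) (x : B.carrier) : Prop :=
  (∃ v u, x ∈ B.dir v u) ∧
  ∀ n : ℕ, 1 ≤ n → n ≠ 2 → ∀ (w : ℕ → P) (a : Fin n → B.carrier),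
    (∀ i : Fin n, a i ∈ B.dir (w i) (w (i + 1))) → (∃ i, a i = x) → B.b n a = 0

/-- `unit` is the family of (nonzero) strict units `𝔢_u` of `B`. -/
structure BAlgebra.IsStrictUnits (B : BAlgebra.{uk, uS, uP, uZ} k e) (unit : P → B.carrier) :
    Prop where
  ne_zero : ∀ u, unit u ≠ 0
  deg : ∀ u, unit u ∈ B.deg (-1)
  dir : ∀ u, unit u = B.lact (e u) (B.ract (e u) (unit u))
  strict : ∀ u, B.IsStrict (unit u)
  left_unit : ∀ u q, ∀ a ∈ B.deg q, B.b 2 ![unit u, a] = B.lact (e u) a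
  right_unit : ∀ u q, ∀ a ∈ B.deg q,
    B.b 2 ![a, unit u] = (q + 1).negOnePow • B.ract (e u) a

/-! ### `(b, ν)`-algebras -/

/-- A two-sided translation on a graded bimodule `Z`: an automorphism `ν` of `S` of infinite
order, which permutes the idempotents `e_u` freely (`perm` is the induced permutation of the
indices), and commuting left and right actions of the infinite cyclic group `⟨ν⟩` on `Z`, given
by the automorphisms `L a = ν a` and `R a = a ν` of degree `-1`. -/
structure Translation (M : GradedBimodule.{uk, uS, uP, uZ} k e) where
  ν : S ≃ₗ[k] S
  ν_mul : ∀ s t, ν (s * t) = ν s * ν t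
  perm : Equiv.Perm P
  ν_e : ∀ u, ν (e u) = e (perm u)
  infinite_order : ∀ t : ℤ, t ≠ 0 → ν ^ t ≠ 1
  free : ∀ (u : P) (t : ℤ), t ≠ 0 → (perm ^ t) u ≠ u
  L : M.carrier ≃ₗ[k] M.carrier
  R : M.carrier ≃ₗ[k] M.carrier
  L_deg : ∀ q, ∀ a ∈ M.deg q, L a ∈ M.deg (q - 1)
  R_deg : ∀ q, ∀ a ∈ M.deg q, R a ∈ M.deg (q - 1)
  comm : ∀ a, R (L a) = L (R a)
  L_lact : ∀ u a, L (M.lact (e u) a) = M.lact (ν (e u)) (L a)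
  L_ract : ∀ u a, L (M.ract (e u) a) = M.ract (e u) (L a)
  R_ract : ∀ u a, R (M.ract (e u) a) = M.ract (ν.symm (e u)) (R a)
  R_lact : ∀ u a, R (M.lact (e u) a) = M.lact (e u) (R a)

/-- `Q` is a complete set of representatives of the `⟨ν⟩`-orbits of indices. -/
def Translation.IsReps {M : GradedBimodule.{uk, uS, uP, uZ} k e} (T : Translation M)
    (Q : Set P) : Prop :=
  ∀ u : P, ∃! v : P, v ∈ Q ∧ ∃ t : ℤ, (T.perm ^ t) v = u

/-- The subspace `Z_{s,t} = ⊕ e_v Z e_u`, with `v ∈ ν^s(Q)` and `u ∈ ν^t(Q)`. -/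
def Translation.block {M : GradedBimodule.{uk, uS, uP, uZ} k e} (T : Translation M)
    (Q : Set P) (s t : ℤ) : Submodule k M.carrier :=
  ⨆ v ∈ Q, ⨆ u ∈ Q, M.dir ((T.perm ^ s) v) ((T.perm ^ t) u)

/-- `ρ_{s,t}(a) = ν^{-s} a ν^t`, a map of degree `s - t`. -/
def Translation.rho {M : GradedBimodule.{uk, uS, uP, uZ} k e} (T : Translation M) (s t : ℤ) :
    M.carrier ≃ₗ[k] M.carrier :=
  T.L ^ (-s) * T.R ^ t

/-- The `b`-algebra `B` with the two-sided translation `T` is a `(b, ν)`-algebra: for some set of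
representatives, `b_n = (-1)^{s_0 - s_n} ρ_{s_0,s_n}⁻¹ b_n (ρ_{s_0,s_1} ⊗ ⋯ ⊗ ρ_{s_{n-1},s_n})`
on `Z_{s_0,s_1} ⊗ ⋯ ⊗ Z_{s_{n-1},s_n}`.  On homogeneous `a_1 ⊗ ⋯ ⊗ a_n` the Koszul sign of the
tensor product of the `ρ`'s is `(-1)^{∑_l (s_l - s_n) |a_l|}`. -/
def Translation.IsBNuAlgebra {B : BAlgebra.{uk, uS, uP, uZ} k e}
    (T : Translation B.toGradedBimodule) : Prop :=
  ∃ Q : Set P, T.IsReps Q ∧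
    ∀ n : ℕ, 1 ≤ n → ∀ (s : ℕ → ℤ) (d : ℕ → ℤ) (a : Fin n → B.carrier),
      (∀ i : Fin n, a i ∈ T.block Q (s i) (s (i + 1)) ⊓ B.deg (d i)) →
      B.b n a =
        (s 0 - s n + ∑ i ∈ Finset.range n, (s (i + 1) - s n) * d i).negOnePow •
          (T.rho (s 0) (s n)).symm (B.b n fun i => T.rho (s i) (s (i + 1)) (a i))

/-! ### Right modules with finite support -/

variable (k e) in
/-- A unitary right `S`-module with finite support; `act s x` is `x s`. -/
structure FSMod where
  carrier : Type uX
  [addCommGroup : AddCommGroup carrier]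
  [module : Module k carrier]
  act : S →ₗ[k] carrier →ₗ[k] carrier
  act_mul : ∀ s t x, act (s * t) x = act t (act s x)
  top : ⨆ u, LinearMap.range (act (e u)) = ⊤
  finite_support : {u | LinearMap.range (act (e u)) ≠ ⊥}.Finite

attribute [instance] FSMod.addCommGroup FSMod.module

/-- The subspace `X e_u`. -/
def FSMod.comp (X : FSMod.{uk, uS, uP, uX} k e) (u : P) : Submodule k X.carrier :=
  LinearMap.range (X.act (e u))

/-- Morphisms of right `S`-modules. -/
structure FSMod.Hom (X Y : FSMod.{uk, uS, uP, uX} k e) where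
  toLin : X.carrier →ₗ[k] Y.carrier
  map_act : ∀ s x, toLin (X.act s x) = Y.act s (toLin x)

/-- The restriction `f_u : X e_u → Y e_u` of a morphism of right `S`-modules. -/
def FSMod.Hom.res {X Y : FSMod.{uk, uS, uP, uX} k e} (f : X.Hom Y) (u : P) :
    X.comp u →ₗ[k] Y.comp u :=
  f.toLin.restrict (by
    rintro _ ⟨y, rfl⟩
    exact ⟨f.toLin y, (f.map_act (e u) y).symm⟩)

/-- The identity morphism of a right `S`-module. -/
def FSMod.idHom (X : FSMod.{uk, uS, uP, uX} k e) : X.Hom X where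
  toLin := LinearMap.id
  map_act := fun _ _ => rfl

/-! ### The `b`-category `ad(Z)` -/

section Ad

variable (B : BAlgebra.{uk, uS, uP, uZ} k e)

/-- The ambient space `Hom_k(X, Y) ⊗ Z` of `ad(Z)(X, Y) = ⊕ Hom_k(X e_u, Y e_v) ⊗ e_v Z e_u`,
where `Hom_k(X e_u, Y e_v)` is identified with a subspace of `Hom_k(X, Y)`. -/
abbrev BAlgebra.Amb (X Y : FSMod.{uk, uS, uP, uX} k e) : Type max uX uZ :=
  (X.carrier →ₗ[k] Y.carrier) ⊗[k] B.carrier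

/-- The homogeneous component of degree `q` of `ad(Z)(X, Y)`: it is spanned by the `f ⊗ a` with
`f ∈ Hom_k(X e_u, Y e_v)` and `a ∈ e_v Z_q e_u`. -/
def BAlgebra.adDeg (X Y : FSMod.{uk, uS, uP, uX} k e) (q : ℤ) : Submodule k (B.Amb X Y) :=
  Submodule.span k {t | ∃ (u v : P) (f : X.carrier →ₗ[k] Y.carrier) (a : B.carrier),
    Y.act (e v) ∘ₗ f ∘ₗ X.act (e u) = f ∧ a ∈ B.dir v u ⊓ B.deg q ∧ t = f ⊗ₜ[k] a}

/-- Words `f_n ⋯ f_1 ⊗ (a_n ⊗ ⋯ ⊗ a_1)`: the space in which sequences of composable morphisms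
of `ad(Z)` are multiplied before an operation `b_n` is applied to them. -/
abbrev BAlgebra.Word (X Y : FSMod.{uk, uS, uP, uX} k e) : Type max uX uZ uk :=
  (X.carrier →ₗ[k] Y.carrier) ⊗[k] TensorAlgebra k B.carrier

/-- A morphism as a word of length one. -/
def BAlgebra.letter (X Y : FSMod.{uk, uS, uP, uX} k e) : B.Amb X Y →ₗ[k] B.Word X Y :=
  LinearMap.lTensor _ (TensorAlgebra.ι k)

/-- Concatenation of words: `(g ⊗ w) (f ⊗ v) = g f ⊗ w v`. -/
def BAlgebra.wcomp (X Y W : FSMod.{uk, uS, uP, uX} k e) :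
    B.Word Y W →ₗ[k] B.Word X Y →ₗ[k] B.Word X W :=
  TensorProduct.map₂ (LinearMap.llcomp k X.carrier Y.carrier W.carrier)
    (LinearMap.mul k (TensorAlgebra k B.carrier))

/-- The power `δ^{⊗ n}`, as a word. -/
def BAlgebra.wpow (X : FSMod.{uk, uS, uP, uX} k e) (δ : B.Amb X X) : ℕ → B.Word X X
  | 0 => LinearMap.id ⊗ₜ[k] 1
  | n + 1 => B.wcomp X X X (B.letter X X δ) (BAlgebra.wpow X δ n)

/-- All the operations `b_n` together, as a linear map on the tensor algebra. -/
def BAlgebra.bTot : TensorAlgebra k B.carrier →ₗ[k] B.carrier :=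
  DirectSum.toModule k ℕ B.carrier (fun n => PiTensorProduct.lift (B.b n)) ∘ₗ
    TensorAlgebra.toDirectSum.toLinearMap

/-- The operations `b_n^{ad}`: a word `f_n ⋯ f_1 ⊗ (a_n ⊗ ⋯ ⊗ a_1)` of length `n` is sent to
`f_n ⋯ f_1 ⊗ b_n(a_n ⊗ ⋯ ⊗ a_1)`. -/
def BAlgebra.bAd (X Y : FSMod.{uk, uS, uP, uX} k e) : B.Word X Y →ₗ[k] B.Amb X Y :=
  LinearMap.lTensor _ B.bTot

theorem BAlgebra.bTot_tprod (n : ℕ) (a : Fin n → B.carrier) :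
    B.bTot (TensorAlgebra.tprod k B.carrier n a) = B.b n a := by
  simp only [BAlgebra.bTot, LinearMap.comp_apply, AlgHom.toLinearMap_apply]
  rw [← TensorPower.toTensorAlgebra_tprod]
  have h := TensorAlgebra.toDirectSum_ofDirectSum
    (DirectSum.of (fun n => ⨂[k]^n B.carrier) n (PiTensorProduct.tprod k a))
  rw [TensorAlgebra.ofDirectSum_of_tprod] at h
  rw [TensorPower.toTensorAlgebra_tprod, h]
  exact (DirectSum.toModule_lof k n _).trans (PiTensorProduct.lift.tprod a)

end Ad

/-! ### Twisted modules and the precategory `𝒵(Z)` -/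

section Tw

/-- An object `(X, δ)` of `tw(Z)`.  Given a basis of `Z`, the coefficients `f_x` of
`δ = ∑ f_x ⊗ x` are the contractions of `δ` with the dual basis, and each contraction with a
linear form is a linear combination of them; so the filtration condition on the `f_x` is stated
for the contractions of `δ` with all linear forms on `Z`. -/
structure TwObj (B : BAlgebra.{uk, uS, uP, uZ} k e) where
  mod : FSMod.{uk, uS, uP, uX} k e
  δ : B.Amb mod mod
  δ_mem : δ ∈ B.adDeg mod mod 0
  filtered : ∃ (l : ℕ) (F : ℕ → Submodule k mod.carrier),
    F 0 = ⊥ ∧ F l = ⊤ ∧ Monotone F ∧ (∀ r s, ∀ x ∈ F r, mod.act s x ∈ F r) ∧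
    ∀ (φ : B.carrier →ₗ[k] k) (r : ℕ), r < l → ∀ x ∈ F (r + 1),
      TensorProduct.rid k _ (LinearMap.lTensor (mod.carrier →ₗ[k] mod.carrier) φ δ) x ∈ F r
  maurerCartan : ∑ᶠ s : ℕ, B.bAd mod mod (B.wpow mod δ (s + 1)) = 0

variable {B : BAlgebra.{uk, uS, uP, uZ} k e}

/-- The space that contains `tw(Z)(X, Y) = ad(Z)(X, Y)`. -/
abbrev TwObj.Amb (X Y : TwObj.{uk, uS, uP, uZ, uX} B) : Type max uX uZ := B.Amb X.mod Y.mod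

/-- `b_1^{tw}(f) = ∑ b^{ad}(δ_Y^{⊗ i_1} ⊗ f ⊗ δ_X^{⊗ i_0})`, a finite sum. -/
def TwObj.b1 {X Y : TwObj.{uk, uS, uP, uZ, uX} B} (f : X.Amb Y) : X.Amb Y :=
  ∑ᶠ i : ℕ × ℕ, B.bAd X.mod Y.mod
    (B.wcomp X.mod Y.mod Y.mod (B.wpow Y.mod Y.δ i.2)
      (B.wcomp X.mod X.mod Y.mod (B.letter X.mod Y.mod f) (B.wpow X.mod X.δ i.1)))

/-- `g ⋆ f = b_2^{tw}(g ⊗ f) = ∑ b^{ad}(δ_W^{⊗ i_2} ⊗ g ⊗ δ_Y^{⊗ i_1} ⊗ f ⊗ δ_X^{⊗ i_0})`, a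
finite sum. -/
def TwObj.star {X Y W : TwObj.{uk, uS, uP, uZ, uX} B} (g : Y.Amb W) (f : X.Amb Y) : X.Amb W :=
  ∑ᶠ i : ℕ × ℕ × ℕ, B.bAd X.mod W.mod
    (B.wcomp X.mod W.mod W.mod (B.wpow W.mod W.δ i.2.2)
      (B.wcomp X.mod Y.mod W.mod (B.letter Y.mod W.mod g)
        (B.wcomp X.mod Y.mod Y.mod (B.wpow Y.mod Y.δ i.2.1)
          (B.wcomp X.mod X.mod Y.mod (B.letter X.mod Y.mod f) (B.wpow X.mod X.δ i.1)))))

/-- `f : X → Y` is a morphism of the precategory `𝒵(Z)`: it lies in `ad(Z)(X, Y)_{-1}` and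
`b_1^{tw}(f) = 0`. -/
def TwObj.IsMor {X Y : TwObj.{uk, uS, uP, uZ, uX} B} (f : X.Amb Y) : Prop :=
  f ∈ B.adDeg X.mod Y.mod (-1) ∧ TwObj.b1 f = 0

/-- `f` is a kernel of `g` in `𝒵(Z)`. -/
def TwObj.IsKernel {X E Y : TwObj.{uk, uS, uP, uZ, uX} B} (f : X.Amb E) (g : E.Amb Y) : Prop :=
  TwObj.star g f = 0 ∧
  ∀ (W : TwObj.{uk, uS, uP, uZ, uX} B) (h : W.Amb E), TwObj.IsMor h → TwObj.star g h = 0 →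
    ∃! h' : W.Amb X, TwObj.IsMor h' ∧ TwObj.star f h' = h

/-- `g` is a cokernel of `f` in `𝒵(Z)`. -/
def TwObj.IsCokernel {X E Y : TwObj.{uk, uS, uP, uZ, uX} B} (f : X.Amb E) (g : E.Amb Y) : Prop :=
  TwObj.star g f = 0 ∧
  ∀ (W : TwObj.{uk, uS, uP, uZ, uX} B) (h : E.Amb W), TwObj.IsMor h → TwObj.star h f = 0 →
    ∃! h' : Y.Amb W, TwObj.IsMor h' ∧ TwObj.star h' g = h

/-! ### Special morphisms and special conflations -/

/-- `L(φ) = ∑_u φ_u ⊗ 𝔢_u`, a finite sum because `X` has finite support; here `φ_u` is regarded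
as the linear map `x ↦ φ (x e_u)` on `X`. -/
def TwObj.lift (unit : P → B.carrier) {X Y : TwObj.{uk, uS, uP, uZ, uX} B}
    (φ : X.mod.Hom Y.mod) : X.Amb Y :=
  ∑ᶠ u : P, (φ.toLin ∘ₗ X.mod.act (e u)) ⊗ₜ[k] unit u

/-- The identity `∑_u id_{X e_u} ⊗ 𝔢_u` of `X` in `𝒵(Z)`. -/
def TwObj.one (unit : P → B.carrier) (X : TwObj.{uk, uS, uP, uZ, uX} B) : X.Amb X :=
  TwObj.lift unit X.mod.idHom

/-- `f` is a special morphism of `𝒵(Z)`. -/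
def TwObj.IsSpecial (unit : P → B.carrier) {X Y : TwObj.{uk, uS, uP, uZ, uX} B}
    (f : X.Amb Y) : Prop :=
  TwObj.IsMor f ∧ ∃ φ : X.mod.Hom Y.mod, f = TwObj.lift unit φ

/-- `X → E → Y` is a special conflation of `𝒵(Z)`: `f = ∑ φ_u ⊗ 𝔢_u` and `g = ∑ ψ_u ⊗ 𝔢_u` are
special morphisms, and `0 → X e_u → E e_u → Y e_u → 0` is exact for all `u`. -/
def TwObj.IsSpecialConflation (unit : P → B.carrier) {X E Y : TwObj.{uk, uS, uP, uZ, uX} B}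
    (f : X.Amb E) (g : E.Amb Y) : Prop :=
  TwObj.IsMor f ∧ TwObj.IsMor g ∧
  ∃ (φ : X.mod.Hom E.mod) (ψ : E.mod.Hom Y.mod),
    f = TwObj.lift unit φ ∧ g = TwObj.lift unit ψ ∧
    ∀ u, Function.Injective (φ.res u) ∧ Function.Exact (φ.res u) (ψ.res u) ∧
      Function.Surjective (ψ.res u)

/-- `f` is a special inflation. -/
def TwObj.IsSpecialInflation (unit : P → B.carrier) {X E : TwObj.{uk, uS, uP, uZ, uX} B}
    (f : X.Amb E) : Prop :=
  ∃ (Y : TwObj.{uk, uS, uP, uZ, uX} B) (g : E.Amb Y), TwObj.IsSpecialConflation unit f g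

/-- `g` is a special deflation. -/
def TwObj.IsSpecialDeflation (unit : P → B.carrier) {E Y : TwObj.{uk, uS, uP, uZ, uX} B}
    (g : E.Amb Y) : Prop :=
  ∃ (X : TwObj.{uk, uS, uP, uZ, uX} B) (f : X.Amb E), TwObj.IsSpecialConflation unit f g

end Tw

end Algebra

end SpecialConflations

end

/-!
The argument rests on two computations in the `b`-category of twisted modules.

*Strict units.*  For a morphism of modules `φ` write `L(φ) = ∑_u φ_u ⊗ 𝔢_u`.  Since `b_n` kills
composable sequences that contain a unit when `n ≠ 2`, composing with `L(φ)` on either side is just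
composing with the linear map `φ` in the first tensor factor (`TwObj.star_lift_left`,
`TwObj.star_lift_right`), and `b_1^{tw}(L(φ)) = φ δ_X - δ_Y φ` (`TwObj.b1_lift`).  So special
morphisms are the morphisms of modules that commute with the `δ`'s.  An injective one is a special
inflation and a surjective one is a special deflation, because `δ_E` induces a `δ` on the cokernel,
respectively on the kernel (`TwObj.isSpecialInflation_iff`, `TwObj.isSpecialDeflation_iff`).  As `S`
is elementary, modules are graded vector spaces and short exact sequences of them split
(`FSMod.Hom.exists_splitting`); linear maps that commute with the `δ`'s can be pulled out of
`b_1^{tw}` (`TwObj.b1_post`, `TwObj.b1_pre`).  The statements on kernels, cokernels, compositions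
and identities follow.

*The differential.*  On elements of degree `-1` the operation `b_1^{tw}` squares to zero
(`TwObj.b1_b1`).  Given a special conflation `X → E → Y` with maps `φ` and `ψ`, a retraction
`r : E → X` and a morphism `h : X → X'`, the cycle `b_1^{tw}(h r)` vanishes on `X`, so it is `γ ψ`
for a cycle `γ` of degree `0` from `Y` to `X'`.  The matrix `[[δ_X', γ], [0, δ_Y]]` makes `X' ⊕ Y` a
twisted module, because its Maurer-Cartan equation says that `b_1^{tw}(γ) = 0`
(`TwObj.extδ_maurerCartan`), and `h r + L(ψ)` is the wanted morphism from `E` to it.  Pullbacks are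
dual, with a section in place of the retraction.

The relations of the `b`-algebra are given for homogeneous elements of `Z`; they pass to
`Hom_k(X, Y) ⊗ Z` by multilinearity (`BAlgebra.sum_relTerm`).
-/

noncomputable section

namespace SpecialConflations

/-! ### Right modules over an elementary algebra -/

namespace FSMod

variable {k : Type uk} {S : Type uS} {P : Type uP} [Field k] [NonUnitalRing S]
  [Module k S] {e : P → S}

/-- The finite set of indices `u` with `X e_u ≠ 0`. -/
def supp (X : FSMod.{uk, uS, uP, uX} k e) : Finset P :=
  X.finite_support.toFinset

theorem act_eq_zero_of_notMem (X : FSMod.{uk, uS, uP, uX} k e) {u : P} (hu : u ∉ X.supp) :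
    X.act (e u) = 0 := by
  simpa [supp, LinearMap.range_eq_bot] using hu

variable [IsScalarTower k S S] [SMulCommClass k S S]

theorem act_comp_self (hS : IsElementary k e) (X : FSMod.{uk, uS, uP, uX} k e) (u : P) :
    X.act (e u) ∘ₗ X.act (e u) = X.act (e u) := by
  ext x
  rw [LinearMap.comp_apply, ← X.act_mul, hS.idem]

theorem act_act_self (hS : IsElementary k e) (X : FSMod.{uk, uS, uP, uX} k e) (u : P)
    (x : X.carrier) : X.act (e u) (X.act (e u) x) = X.act (e u) x :=
  LinearMap.congr_fun (X.act_comp_self hS u) x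

theorem act_comp_of_ne (hS : IsElementary k e) (X : FSMod.{uk, uS, uP, uX} k e) {u v : P}
    (h : u ≠ v) : X.act (e u) ∘ₗ X.act (e v) = 0 := by
  ext x
  rw [LinearMap.comp_apply, ← X.act_mul, hS.orth v u h.symm]
  simp

theorem act_act_of_ne (hS : IsElementary k e) (X : FSMod.{uk, uS, uP, uX} k e) {u v : P}
    (h : u ≠ v) (x : X.carrier) : X.act (e u) (X.act (e v) x) = 0 :=
  LinearMap.congr_fun (X.act_comp_of_ne hS h) x

theorem sum_act_eq_of_subset (hS : IsElementary k e) (X : FSMod.{uk, uS, uP, uX} k e)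
    {s : Finset P} (hs : X.supp ⊆ s) : ∑ u ∈ s, X.act (e u) = LinearMap.id := by
  classical
  ext x
  have hx : x ∈ ⨆ u, LinearMap.range (X.act (e u)) := by rw [X.top]; trivial
  induction hx using Submodule.iSup_induction' with
  | mem v y hy =>
    obtain ⟨y, rfl⟩ := hy
    rw [LinearMap.sum_apply, Finset.sum_eq_single v]
    · exact X.act_act_self hS v y
    · intro u _ hu
      exact X.act_act_of_ne hS hu y
    · intro hv
      rw [X.act_eq_zero_of_notMem (fun h => hv (hs h))]
      simp
  | zero => simp
  | add y z _ _ hy hz => rw [map_add, hy, hz, map_add]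

theorem sum_act (hS : IsElementary k e) (X : FSMod.{uk, uS, uP, uX} k e) :
    ∑ u ∈ X.supp, X.act (e u) = LinearMap.id :=
  X.sum_act_eq_of_subset hS subset_rfl

theorem sum_act_apply (hS : IsElementary k e) (X : FSMod.{uk, uS, uP, uX} k e) (x : X.carrier) :
    ∑ u ∈ X.supp, X.act (e u) x = x := by
  simpa using LinearMap.congr_fun (X.sum_act hS) x

theorem eq_zero_of_act (hS : IsElementary k e) (X : FSMod.{uk, uS, uP, uX} k e) {x : X.carrier}
    (h : ∀ u, X.act (e u) x = 0) : x = 0 := by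
  rw [← X.sum_act_apply hS x]
  exact Finset.sum_eq_zero fun u _ => h u

theorem hom_ext_act (hS : IsElementary k e) (X : FSMod.{uk, uS, uP, uX} k e) {V : Type*}
    [AddCommGroup V] [Module k V] {f g : X.carrier →ₗ[k] V}
    (h : ∀ u, f ∘ₗ X.act (e u) = g ∘ₗ X.act (e u)) : f = g := by
  ext x
  rw [← X.sum_act_apply hS x, map_sum, map_sum]
  exact Finset.sum_congr rfl fun u _ => LinearMap.congr_fun (h u) x

/-- Over an elementary algebra every `s` acts on `X e_u` by a scalar that does not depend on `X`:
the one with `e_u s e_u = c e_u`. -/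
theorem act_act_eq_smul (hS : IsElementary k e) (X : FSMod.{uk, uS, uP, uX} k e) (s : S) (u : P)
    (x : X.carrier) : X.act s (X.act (e u) x) = (hS.diag u s).choose • X.act (e u) x := by
  rw [← X.act_mul, ← X.sum_act_apply hS (X.act (e u * s) x)]
  have hdiag := (hS.diag u s).choose_spec
  have key : X.act (e u) (X.act (e u * s) x) = (hS.diag u s).choose • X.act (e u) x := by
    rw [← X.act_mul]
    exact (congrArg (fun t => X.act t x) hdiag).trans (by rw [map_smul, LinearMap.smul_apply])
  rw [← key, Finset.sum_eq_single u]
  · intro v _ hv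
    rw [← X.act_mul, hS.offdiag v u hv]
    simp
  · intro hu
    rw [X.act_eq_zero_of_notMem hu]
    simp

/-- A linear map that commutes with the idempotents is a morphism of modules. -/
def homOfComm (hS : IsElementary k e) {X Y : FSMod.{uk, uS, uP, uX} k e}
    (f : X.carrier →ₗ[k] Y.carrier)
    (hf : ∀ u, f ∘ₗ X.act (e u) = Y.act (e u) ∘ₗ f) : X.Hom Y where
  toLin := f
  map_act s x := by
    have h : f ∘ₗ X.act s = Y.act s ∘ₗ f := by
      refine X.hom_ext_act hS fun u => ?_
      ext x
      have hx := LinearMap.congr_fun (hf u) x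
      simp only [LinearMap.comp_apply] at hx ⊢
      rw [X.act_act_eq_smul hS, map_smul, hx, Y.act_act_eq_smul hS]
    exact LinearMap.congr_fun h x

/-- The morphism of modules `∑ e_u f e_u` obtained from a linear map `f`. -/
def avg (hS : IsElementary k e) {X Y : FSMod.{uk, uS, uP, uX} k e}
    (f : X.carrier →ₗ[k] Y.carrier) : X.Hom Y :=
  homOfComm hS (∑ u ∈ X.supp, Y.act (e u) ∘ₗ f ∘ₗ X.act (e u)) (by
    classical
    intro v
    ext x
    simp only [LinearMap.comp_apply, LinearMap.sum_apply, map_sum]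
    refine Finset.sum_congr rfl fun u _ => ?_
    rcases eq_or_ne u v with rfl | h
    · rw [X.act_act_self hS, Y.act_act_self hS]
    · rw [X.act_act_of_ne hS h, Y.act_act_of_ne hS h.symm]
      simp)

theorem avg_toLin (hS : IsElementary k e) {X Y : FSMod.{uk, uS, uP, uX} k e}
    (f : X.carrier →ₗ[k] Y.carrier) :
    (avg hS f).toLin = ∑ u ∈ X.supp, Y.act (e u) ∘ₗ f ∘ₗ X.act (e u) := rfl

end FSMod

namespace FSMod.Hom

variable {k : Type uk} {S : Type uS} {P : Type uP} [Field k] [NonUnitalRing S]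
  [Module k S] {e : P → S}

theorem comp_act {X Y : FSMod.{uk, uS, uP, uX} k e} (f : X.Hom Y) (s : S) :
    f.toLin ∘ₗ X.act s = Y.act s ∘ₗ f.toLin :=
  LinearMap.ext fun x => f.map_act s x

@[ext] theorem ext {X Y : FSMod.{uk, uS, uP, uX} k e} {f g : X.Hom Y}
    (h : f.toLin = g.toLin) : f = g := by
  cases f; cases g; cases h; rfl

/-- Composition of morphisms of modules. -/
def comp {X Y W : FSMod.{uk, uS, uP, uX} k e} (g : Y.Hom W) (f : X.Hom Y) : X.Hom W where
  toLin := g.toLin ∘ₗ f.toLin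
  map_act s x := by simp only [LinearMap.comp_apply, f.map_act, g.map_act]

theorem comp_toLin {X Y W : FSMod.{uk, uS, uP, uX} k e} (g : Y.Hom W) (f : X.Hom Y) :
    (g.comp f).toLin = g.toLin ∘ₗ f.toLin := rfl

variable [IsScalarTower k S S] [SMulCommClass k S S]

theorem injective_iff_res (hS : IsElementary k e) {X Y : FSMod.{uk, uS, uP, uX} k e}
    (f : X.Hom Y) : Function.Injective f.toLin ↔ ∀ u, Function.Injective (f.res u) := by
  constructor
  · intro h u x y hxy
    exact Subtype.ext (h (congrArg Subtype.val hxy))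
  · intro h
    rw [injective_iff_map_eq_zero]
    intro x hx
    refine X.eq_zero_of_act hS fun u => ?_
    have := (injective_iff_map_eq_zero _).1 (h u) ⟨X.act (e u) x, x, rfl⟩ (by
      refine Subtype.ext ?_
      change f.toLin (X.act (e u) x) = 0
      rw [f.map_act, hx, map_zero])
    exact congrArg Subtype.val this

theorem surjective_iff_res (hS : IsElementary k e) {X Y : FSMod.{uk, uS, uP, uX} k e}
    (f : X.Hom Y) : Function.Surjective f.toLin ↔ ∀ u, Function.Surjective (f.res u) := by
  constructor
  · rintro h u ⟨_, y, rfl⟩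
    obtain ⟨x, rfl⟩ := h y
    exact ⟨⟨X.act (e u) x, x, rfl⟩, Subtype.ext (f.map_act _ _)⟩
  · intro h y
    choose x hx using fun u => h u ⟨Y.act (e u) y, y, rfl⟩
    refine ⟨∑ u ∈ Y.supp, (x u : X.carrier), ?_⟩
    rw [map_sum]
    refine Eq.trans (Finset.sum_congr rfl fun u _ => ?_) (Y.sum_act_apply hS y)
    exact congrArg Subtype.val (hx u)

theorem exact_iff_res (hS : IsElementary k e) {X Y W : FSMod.{uk, uS, uP, uX} k e}
    (f : X.Hom Y) (g : Y.Hom W) :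
    Function.Exact f.toLin g.toLin ↔ ∀ u, Function.Exact (f.res u) (g.res u) := by
  constructor
  · rintro h u ⟨_, y, rfl⟩
    constructor
    · intro hy
      obtain ⟨x, hx⟩ := (h _).1 (congrArg Subtype.val hy)
      refine ⟨⟨X.act (e u) x, x, rfl⟩, Subtype.ext ?_⟩
      change f.toLin (X.act (e u) x) = Y.act (e u) y
      rw [f.map_act, show f.toLin x = Y.act (e u) y from hx, Y.act_act_self hS]
    · rintro ⟨x, hx⟩
      refine Subtype.ext ((h _).2 ⟨x, congrArg Subtype.val hx⟩)
  · intro h y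
    constructor
    · intro hy
      have hu : ∀ u, ∃ x, f.toLin x = Y.act (e u) y := fun u => by
        obtain ⟨x, hx⟩ := (h u ⟨Y.act (e u) y, y, rfl⟩).1 (Subtype.ext (by
          change g.toLin (Y.act (e u) y) = 0
          rw [g.map_act, hy, map_zero]))
        exact ⟨x, congrArg Subtype.val hx⟩
      choose x hx using hu
      refine ⟨∑ u ∈ Y.supp, x u, ?_⟩
      rw [map_sum]
      exact Eq.trans (Finset.sum_congr rfl fun u _ => hx u) (Y.sum_act_apply hS y)
    · rintro ⟨x, rfl⟩
      refine W.eq_zero_of_act hS fun u => ?_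
      have := (h u (f.res u ⟨X.act (e u) x, x, rfl⟩)).2 ⟨_, rfl⟩
      have h' : g.toLin (f.toLin (X.act (e u) x)) = 0 := congrArg Subtype.val this
      rwa [f.map_act, g.map_act] at h'

/-- The average of a linear retraction is a retraction. -/
theorem exists_retraction (hS : IsElementary k e) {X E : FSMod.{uk, uS, uP, uX} k e}
    (f : X.Hom E) (hf : Function.Injective f.toLin) :
    ∃ r : E.Hom X, r.toLin ∘ₗ f.toLin = LinearMap.id := by
  obtain ⟨r, hr⟩ := f.toLin.exists_leftInverse_of_injective (LinearMap.ker_eq_bot.2 hf)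
  refine ⟨FSMod.avg hS r, ?_⟩
  refine X.hom_ext_act hS fun v => ?_
  classical
  ext x
  have hrx : ∀ y, r (f.toLin y) = y := fun y => LinearMap.congr_fun hr y
  simp only [FSMod.avg_toLin, LinearMap.comp_apply, LinearMap.sum_apply, LinearMap.id_apply]
  calc ∑ u ∈ E.supp, X.act (e u) (r (E.act (e u) (f.toLin (X.act (e v) x))))
      = ∑ u ∈ E.supp, X.act (e u) (r (f.toLin (X.act (e u) (X.act (e v) x)))) := by
        simp only [f.map_act]
    _ = X.act (e v) x := by
        simp only [hrx]
        rw [Finset.sum_eq_single v]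
        · rw [X.act_act_self hS, X.act_act_self hS]
        · intro u _ hu
          rw [X.act_act_of_ne hS hu, map_zero]
        · intro hv
          rw [X.act_act_self hS, X.act_act_self hS]
          refine hf ?_
          rw [f.map_act, E.act_eq_zero_of_notMem hv]
          simp

/-- The average of a linear section is a section. -/
theorem exists_section (hS : IsElementary k e) {E Y : FSMod.{uk, uS, uP, uX} k e}
    (g : E.Hom Y) (hg : Function.Surjective g.toLin) :
    ∃ s : Y.Hom E, g.toLin ∘ₗ s.toLin = LinearMap.id := by
  obtain ⟨s, hs⟩ := g.toLin.exists_rightInverse_of_surjective (LinearMap.range_eq_top.2 hg)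
  refine ⟨FSMod.avg hS s, ?_⟩
  ext y
  have hsy : ∀ y, g.toLin (s y) = y := fun y => LinearMap.congr_fun hs y
  simp only [FSMod.avg_toLin, LinearMap.comp_apply, LinearMap.sum_apply, LinearMap.id_apply,
    map_sum, g.map_act, hsy, Y.act_act_self hS]
  exact Y.sum_act_apply hS y

/-- Short exact sequences of modules over an elementary algebra split. -/
theorem exists_splitting (hS : IsElementary k e) {X E Y : FSMod.{uk, uS, uP, uX} k e}
    (f : X.Hom E) (g : E.Hom Y) (hf : Function.Injective f.toLin)
    (hfg : Function.Exact f.toLin g.toLin) (hg : Function.Surjective g.toLin) :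
    ∃ (r : E.Hom X) (s : Y.Hom E), r.toLin ∘ₗ f.toLin = LinearMap.id ∧
      g.toLin ∘ₗ s.toLin = LinearMap.id ∧
      f.toLin ∘ₗ r.toLin + s.toLin ∘ₗ g.toLin = LinearMap.id := by
  obtain ⟨r, hr⟩ := f.exists_retraction hS hf
  obtain ⟨s, hs⟩ := g.exists_section hS hg
  have hrf : ∀ x, r.toLin (f.toLin x) = x := fun x => LinearMap.congr_fun hr x
  have hgs : ∀ x, g.toLin (s.toLin x) = x := fun x => LinearMap.congr_fun hs x
  have hgf : ∀ x, g.toLin (f.toLin x) = 0 := fun x => (hfg _).2 ⟨x, rfl⟩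
  -- the section is corrected so that it takes its values in the kernel of `r`
  refine ⟨r, ⟨s.toLin - f.toLin ∘ₗ r.toLin ∘ₗ s.toLin, fun t x => ?_⟩, hr, ?_, ?_⟩
  · simp [f.map_act, r.map_act, s.map_act]
  · ext y
    simp [hgs, hgf]
  · ext x
    obtain ⟨y, hy⟩ := (hfg (x - s.toLin (g.toLin x))).1 (by simp [hgs])
    have hx : x = f.toLin y + s.toLin (g.toLin x) := by rw [hy]; abel
    have : r.toLin x = y + r.toLin (s.toLin (g.toLin x)) := by
      conv_lhs => rw [hx]
      rw [map_add, hrf]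
    simp only [LinearMap.add_apply, LinearMap.comp_apply, LinearMap.sub_apply, this, map_add,
      LinearMap.id_apply]
    conv_rhs => rw [hx]
    abel

end FSMod.Hom

/-! ### Composition of words with linear maps -/

section Comp

variable {k : Type*} [Field k] {U V W W' : Type*} [AddCommGroup U] [Module k U]
  [AddCommGroup V] [Module k V] [AddCommGroup W] [Module k W] [AddCommGroup W'] [Module k W']
  {T T' : Type*} [AddCommGroup T] [Module k T] [AddCommGroup T'] [Module k T']

/-- Left composition `f ⊗ a ↦ α f ⊗ a` with a linear map `α`. -/
def post (α : V →ₗ[k] W) : (U →ₗ[k] V) ⊗[k] T →ₗ[k] (U →ₗ[k] W) ⊗[k] T :=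
  LinearMap.rTensor T (LinearMap.llcomp k U V W α)

/-- Right composition `f ⊗ a ↦ f β ⊗ a` with a linear map `β`. -/
def pre (β : U →ₗ[k] V) : (V →ₗ[k] W) ⊗[k] T →ₗ[k] (U →ₗ[k] W) ⊗[k] T :=
  LinearMap.rTensor T ((LinearMap.llcomp k U V W).flip β)

@[simp] theorem post_tmul (α : V →ₗ[k] W) (f : U →ₗ[k] V) (a : T) :
    post α (f ⊗ₜ[k] a) = (α ∘ₗ f) ⊗ₜ[k] a := rfl

@[simp] theorem pre_tmul (β : U →ₗ[k] V) (f : V →ₗ[k] W) (a : T) :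
    pre β (f ⊗ₜ[k] a) = (f ∘ₗ β) ⊗ₜ[k] a := rfl

theorem post_post (α : V →ₗ[k] W) (α' : W →ₗ[k] W') (t : (U →ₗ[k] V) ⊗[k] T) :
    post α' (post α t) = post (α' ∘ₗ α) t := by
  induction t with
  | zero => simp
  | tmul f a => rfl
  | add x y hx hy => simp only [map_add, hx, hy]

theorem pre_pre (β : U →ₗ[k] V) (β' : V →ₗ[k] W) (t : (W →ₗ[k] W') ⊗[k] T) :
    pre β (pre β' t) = pre (β' ∘ₗ β) t := by
  induction t with
  | zero => simp
  | tmul f a => rfl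
  | add x y hx hy => simp only [map_add, hx, hy]

theorem post_pre (β : U →ₗ[k] V) (α : W →ₗ[k] W') (t : (V →ₗ[k] W) ⊗[k] T) :
    post α (pre β t) = pre β (post α t) := by
  induction t with
  | zero => simp
  | tmul f a => rfl
  | add x y hx hy => simp only [map_add, hx, hy]

@[simp] theorem post_id (t : (U →ₗ[k] V) ⊗[k] T) : post LinearMap.id t = t := by
  induction t with
  | zero => simp
  | tmul f a => rfl
  | add x y hx hy => simp only [map_add, hx, hy]

@[simp] theorem pre_id (t : (U →ₗ[k] V) ⊗[k] T) : pre LinearMap.id t = t := by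
  induction t with
  | zero => simp
  | tmul f a => rfl
  | add x y hx hy => simp only [map_add, hx, hy]

theorem post_add_left (α α' : V →ₗ[k] W) (t : (U →ₗ[k] V) ⊗[k] T) :
    post (α + α') t = post α t + post α' t := by
  simp [post, LinearMap.rTensor_add]

theorem pre_add_left (β β' : U →ₗ[k] V) (t : (V →ₗ[k] W) ⊗[k] T) :
    pre (β + β') t = pre β t + pre β' t := by
  simp [pre, LinearMap.rTensor_add]

@[simp] theorem post_zero_left (t : (U →ₗ[k] V) ⊗[k] T) : post (0 : V →ₗ[k] W) t = 0 := by
  simp [post]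

@[simp] theorem pre_zero_left (t : (V →ₗ[k] W) ⊗[k] T) : pre (0 : U →ₗ[k] V) t = 0 := by
  simp [pre]

theorem post_injective {α : V →ₗ[k] W} (hα : Function.Injective α) :
    Function.Injective (post α : (U →ₗ[k] V) ⊗[k] T → (U →ₗ[k] W) ⊗[k] T) := by
  obtain ⟨r, hr⟩ := α.exists_leftInverse_of_injective (LinearMap.ker_eq_bot.2 hα)
  intro x y h
  have := congrArg (post r) h
  simpa [post_post, hr] using this

theorem pre_injective {β : U →ₗ[k] V} (hβ : Function.Surjective β) :
    Function.Injective (pre β : (V →ₗ[k] W) ⊗[k] T → (U →ₗ[k] W) ⊗[k] T) := by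
  obtain ⟨r, hr⟩ := β.exists_rightInverse_of_surjective (LinearMap.range_eq_top.2 hβ)
  intro x y h
  have := congrArg (pre r) h
  simpa [pre_pre, hr] using this

theorem lTensor_post (φ : T →ₗ[k] T') (α : V →ₗ[k] W) (t : (U →ₗ[k] V) ⊗[k] T) :
    LinearMap.lTensor _ φ (post α t) = post α (LinearMap.lTensor _ φ t) := by
  induction t with
  | zero => simp
  | tmul f a => rfl
  | add x y hx hy => simp only [map_add, hx, hy]

theorem lTensor_pre (φ : T →ₗ[k] T') (β : U →ₗ[k] V) (t : (V →ₗ[k] W) ⊗[k] T) :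
    LinearMap.lTensor _ φ (pre β t) = pre β (LinearMap.lTensor _ φ t) := by
  induction t with
  | zero => simp
  | tmul f a => rfl
  | add x y hx hy => simp only [map_add, hx, hy]

/-- The contraction of an element of `Hom(U, V) ⊗ T` with a linear form on `T`. -/
def contract (φ : T →ₗ[k] k) : (U →ₗ[k] V) ⊗[k] T →ₗ[k] (U →ₗ[k] V) :=
  (TensorProduct.rid k (U →ₗ[k] V)).toLinearMap ∘ₗ LinearMap.lTensor _ φ

@[simp] theorem contract_tmul (φ : T →ₗ[k] k) (f : U →ₗ[k] V) (a : T) :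
    contract φ (f ⊗ₜ[k] a) = φ a • f := by
  simp [contract]

theorem contract_post (φ : T →ₗ[k] k) (α : V →ₗ[k] W) (t : (U →ₗ[k] V) ⊗[k] T) :
    contract φ (post α t) = α ∘ₗ contract φ t := by
  induction t with
  | zero => simp
  | tmul f a => simp [LinearMap.comp_smul]
  | add x y hx hy => simp only [map_add, hx, hy, LinearMap.comp_add]

theorem contract_pre (φ : T →ₗ[k] k) (β : U →ₗ[k] V) (t : (V →ₗ[k] W) ⊗[k] T) :
    contract φ (pre β t) = contract φ t ∘ₗ β := by
  induction t with
  | zero => simp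
  | tmul f a => simp [LinearMap.smul_comp]
  | add x y hx hy => simp only [map_add, hx, hy, LinearMap.add_comp]

/-- An element of `Hom(U, V) ⊗ T` all of whose contractions lie in `N` belongs to `N ⊗ T`. -/
theorem mem_span_of_contract_mem (N : Submodule k (U →ₗ[k] V)) (t : (U →ₗ[k] V) ⊗[k] T)
    (h : ∀ φ : T →ₗ[k] k, contract φ t ∈ N) :
    t ∈ Submodule.span k {x | ∃ f ∈ N, ∃ a : T, x = f ⊗ₜ[k] a} := by
  classical
  let c := Module.Basis.ofVectorSpace k T
  have key : ∀ (t : (U →ₗ[k] V) ⊗[k] T) i,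
      TensorProduct.equivFinsuppOfBasisRight c t i = contract (c.coord i) t := by
    intro t i
    induction t with
    | zero => simp
    | tmul f a => simp
    | add x y hx hy => simp only [map_add, Finsupp.add_apply, hx, hy]
  have ht : t = (TensorProduct.equivFinsuppOfBasisRight c).symm
      (TensorProduct.equivFinsuppOfBasisRight c t) := by simp
  rw [ht, TensorProduct.equivFinsuppOfBasisRight_symm_apply]
  refine Submodule.sum_mem _ fun i _ => Submodule.subset_span ⟨_, ?_, _, rfl⟩
  rw [key]
  exact h _

end Comp

section Words

variable {k : Type uk} {S : Type uS} {P : Type uP} [Field k] [NonUnitalRing S]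
  [Module k S] {e : P → S} {B : BAlgebra.{uk, uS, uP, uZ} k e}

/-- Concatenation of words. -/
local notation:70 w " ⊙ " v:71 => BAlgebra.wcomp _ _ _ _ w v

namespace BAlgebra

variable {X Y W V : FSMod.{uk, uS, uP, uX} k e}

@[simp] theorem letter_tmul (f : X.carrier →ₗ[k] Y.carrier) (a : B.carrier) :
    B.letter X Y (f ⊗ₜ[k] a) = f ⊗ₜ[k] TensorAlgebra.ι k a := rfl

@[simp] theorem wcomp_tmul (g : Y.carrier →ₗ[k] W.carrier) (f : X.carrier →ₗ[k] Y.carrier)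
    (w v : TensorAlgebra k B.carrier) :
    B.wcomp X Y W (g ⊗ₜ[k] w) (f ⊗ₜ[k] v) = (g ∘ₗ f) ⊗ₜ[k] (w * v) := rfl

@[simp] theorem bAd_tmul (f : X.carrier →ₗ[k] Y.carrier) (w : TensorAlgebra k B.carrier) :
    B.bAd X Y (f ⊗ₜ[k] w) = f ⊗ₜ[k] B.bTot w := rfl

theorem wcomp_assoc (x : B.Word W V) (y : B.Word Y W) (z : B.Word X Y) :
    (x ⊙ y) ⊙ z = x ⊙ (y ⊙ z) := by
  induction x using TensorProduct.induction_on with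
  | zero => simp
  | add a b ha hb => simp only [map_add, LinearMap.add_apply, ha, hb]
  | tmul f a =>
    induction y using TensorProduct.induction_on with
    | zero => simp
    | add a b ha hb => simp only [map_add, LinearMap.add_apply, ha, hb]
    | tmul g b =>
      induction z using TensorProduct.induction_on with
      | zero => simp
      | add a b ha hb => simp only [map_add, ha, hb]
      | tmul h c => simp [LinearMap.comp_assoc, mul_assoc]

theorem wcomp_one (x : B.Word X Y) : x ⊙ (LinearMap.id ⊗ₜ[k] 1) = x := by
  induction x using TensorProduct.induction_on with
  | zero => simp
  | add a b ha hb => simp only [map_add, LinearMap.add_apply, ha, hb]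
  | tmul f a => simp

theorem one_wcomp (x : B.Word X Y) : (LinearMap.id ⊗ₜ[k] 1) ⊙ x = x := by
  induction x using TensorProduct.induction_on with
  | zero => simp
  | add a b ha hb => simp only [map_add, ha, hb]
  | tmul f a => simp

theorem wcomp_post_left (α : W.carrier →ₗ[k] V.carrier) (x : B.Word Y W) (y : B.Word X Y) :
    (post α x : B.Word Y V) ⊙ y = post α (x ⊙ y) := by
  induction x using TensorProduct.induction_on with
  | zero => simp
  | add a b ha hb => simp only [map_add, LinearMap.add_apply, ha, hb]
  | tmul f a =>
    induction y using TensorProduct.induction_on with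
    | zero => simp
    | add a b ha hb => simp only [map_add, ha, hb]
    | tmul g b => rfl

theorem wcomp_pre_right (β : X.carrier →ₗ[k] Y.carrier) (x : B.Word W V) (y : B.Word Y W) :
    x ⊙ (pre β y : B.Word X W) = pre β (x ⊙ y) := by
  induction x using TensorProduct.induction_on with
  | zero => simp
  | add a b ha hb => simp only [map_add, LinearMap.add_apply, ha, hb]
  | tmul f a =>
    induction y using TensorProduct.induction_on with
    | zero => simp
    | add a b ha hb => simp only [map_add, ha, hb]
    | tmul g b => rfl

theorem wcomp_pre_left (β : Y.carrier →ₗ[k] W.carrier) (x : B.Word W V) (y : B.Word X Y) :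
    (pre β x : B.Word Y V) ⊙ y = x ⊙ (post β y : B.Word X W) := by
  induction x using TensorProduct.induction_on with
  | zero => simp
  | add a b ha hb => simp only [map_add, LinearMap.add_apply, ha, hb]
  | tmul f a =>
    induction y using TensorProduct.induction_on with
    | zero => simp
    | add a b ha hb => simp only [map_add, ha, hb]
    | tmul g b => rfl

theorem letter_post (α : Y.carrier →ₗ[k] W.carrier) (x : B.Amb X Y) :
    B.letter X W (post α x) = post α (B.letter X Y x) :=
  lTensor_post _ _ _

theorem letter_pre (β : X.carrier →ₗ[k] Y.carrier) (x : B.Amb Y W) :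
    B.letter X W (pre β x) = pre β (B.letter Y W x) :=
  lTensor_pre _ _ _

theorem bAd_post (α : Y.carrier →ₗ[k] W.carrier) (x : B.Word X Y) :
    B.bAd X W (post α x) = post α (B.bAd X Y x) :=
  lTensor_post _ _ _

theorem bAd_pre (β : X.carrier →ₗ[k] Y.carrier) (x : B.Word Y W) :
    B.bAd X W (pre β x) = pre β (B.bAd Y W x) :=
  lTensor_pre _ _ _

theorem wpow_succ (δ : B.Amb X X) (n : ℕ) :
    B.wpow X δ (n + 1) = B.letter X X δ ⊙ B.wpow X δ n := rfl

theorem wpow_zero (δ : B.Amb X X) : B.wpow X δ 0 = LinearMap.id ⊗ₜ[k] 1 := rfl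

theorem wpow_one (δ : B.Amb X X) : B.wpow X δ 1 = B.letter X X δ := by
  rw [wpow_succ, wpow_zero, wcomp_one]

theorem wpow_add (δ : B.Amb X X) (m n : ℕ) :
    B.wpow X δ (m + n) = B.wpow X δ m ⊙ B.wpow X δ n := by
  induction m with
  | zero => rw [Nat.zero_add, wpow_zero, one_wcomp]
  | succ m ih => rw [Nat.succ_add, wpow_succ, wpow_succ, ih, wcomp_assoc]

theorem wpow_eq_zero_of_le {δ : B.Amb X X} {N n : ℕ} (h : B.wpow X δ N = 0) (hn : N ≤ n) :
    B.wpow X δ n = 0 := by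
  obtain ⟨m, rfl⟩ := Nat.exists_eq_add_of_le hn
  rw [wpow_add, h]
  simp

/-- A linear map that intertwines `δ` and `δ'` intertwines their powers. -/
theorem post_wpow (α : X.carrier →ₗ[k] Y.carrier) {δ : B.Amb X X} {δ' : B.Amb Y Y}
    (h : (post α δ : B.Amb X Y) = pre α δ') (n : ℕ) :
    (post α (B.wpow X δ n) : B.Word X Y) = pre α (B.wpow Y δ' n) := by
  induction n with
  | zero => rfl
  | succ n ih =>
    rw [wpow_succ, wpow_succ, ← wcomp_post_left, ← letter_post, h, letter_pre, wcomp_pre_left, ih,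
      wcomp_pre_right]

theorem bAd_wpow_comm (α : X.carrier →ₗ[k] Y.carrier) {δ : B.Amb X X} {δ' : B.Amb Y Y}
    (h : (post α δ : B.Amb X Y) = pre α δ') (n : ℕ) :
    (post α (B.bAd X X (B.wpow X δ n)) : B.Amb X Y) = pre α (B.bAd Y Y (B.wpow Y δ' n)) := by
  rw [← bAd_post, ← bAd_pre, post_wpow α h]

/-- The contractions of `δ` are strictly triangular with respect to the filtration `F`, so `δ` is
nilpotent. -/
theorem wpow_eq_zero_of_filtered {δ : B.Amb X X} {l : ℕ} {F : ℕ → Submodule k X.carrier}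
    (h0 : F 0 = ⊥) (hl : F l = ⊤) (hF : Monotone F)
    (h : ∀ (φ : B.carrier →ₗ[k] k) (r : ℕ), r < l → ∀ x ∈ F (r + 1), contract φ δ x ∈ F r) :
    B.wpow X δ l = 0 := by
  -- the maps that lower the filtration by `m` steps
  let N : ℕ → Submodule k (X.carrier →ₗ[k] X.carrier) := fun m =>
    { carrier := {f | ∀ r, ∀ x ∈ F (r + m), f x ∈ F r}
      add_mem' := fun {a b} ha hb r x hx => (F r).add_mem (ha r x hx) (hb r x hx)
      zero_mem' := fun r x _ => (F r).zero_mem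
      smul_mem' := fun c a ha r x hx => (F r).smul_mem c (ha r x hx) }
  let G : ℕ → Submodule k (B.Word X X) := fun m =>
    Submodule.span k {x | ∃ f ∈ N m, ∃ a : TensorAlgebra k B.carrier, x = f ⊗ₜ[k] a}
  have hδ : B.letter X X δ ∈ G 1 := by
    have := mem_span_of_contract_mem (N 1) δ (fun φ r x hx => by
      by_cases hr : r < l
      · exact h φ r hr x hx
      · have : F r = ⊤ := top_unique (hl ▸ hF (not_lt.1 hr))
        rw [this]; trivial)
    clear h
    induction this using Submodule.span_induction with
    | mem x hx =>
      obtain ⟨f, hf, a, rfl⟩ := hx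
      exact Submodule.subset_span ⟨f, hf, _, rfl⟩
    | zero => simp
    | add x y _ _ hx hy => rw [map_add]; exact add_mem hx hy
    | smul c x _ hx => rw [map_smul]; exact Submodule.smul_mem _ _ hx
  have hmul : ∀ m n (x y : B.Word X X), x ∈ G m → y ∈ G n → x ⊙ y ∈ G (m + n) := by
    intro m n x y hx hy
    induction hx using Submodule.span_induction with
    | zero => simp
    | add x y _ _ hx hy => rw [map_add]; exact add_mem hx hy
    | smul c x _ hx => rw [map_smul]; exact Submodule.smul_mem _ _ hx
    | mem x hx =>
      obtain ⟨f, hf, a, rfl⟩ := hx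
      induction hy using Submodule.span_induction with
      | zero => simp
      | add x y _ _ hx hy => rw [map_add]; exact add_mem hx hy
      | smul c x _ hx => rw [map_smul]; exact Submodule.smul_mem _ _ hx
      | mem y hy =>
        obtain ⟨g, hg, b, rfl⟩ := hy
        refine Submodule.subset_span ⟨f ∘ₗ g, fun r x hx => hf r _ (hg _ x ?_), a * b, rfl⟩
        rwa [add_assoc]
  have hpow : ∀ n, B.wpow X δ n ∈ G n := by
    intro n
    induction n with
    | zero => exact Submodule.subset_span ⟨LinearMap.id, fun r x hx => hx, 1, rfl⟩
    | succ n ih => rw [wpow_succ, Nat.add_comm]; exact hmul _ _ _ _ hδ ih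
  have hGl : G l ≤ ⊥ := by
    refine Submodule.span_le.2 ?_
    rintro _ ⟨f, hf, a, rfl⟩
    have : f = 0 := by
      ext x
      have := hf 0 x (by rw [Nat.zero_add, hl]; trivial)
      rw [h0] at this
      simpa using this
    simp [this]
  simpa using hGl (hpow l)

end BAlgebra

namespace TwObj

open BAlgebra

variable {X Y W V : TwObj.{uk, uS, uP, uZ, uX} B}

theorem exists_wpow_eq_zero (X : TwObj.{uk, uS, uP, uZ, uX} B) :
    ∃ N, ∀ n, N ≤ n → B.wpow X.mod X.δ n = 0 := by
  obtain ⟨l, F, h0, hl, hF, _, h⟩ := X.filtered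
  exact ⟨l, fun n hn => wpow_eq_zero_of_le (wpow_eq_zero_of_filtered h0 hl hF h) hn⟩

/-- The word `δ_Y^{⊗ j} ⊗ f ⊗ δ_X^{⊗ i}`. -/
def insWord (f : X.Amb Y) (i j : ℕ) : B.Word X.mod Y.mod :=
  B.wpow Y.mod Y.δ j ⊙ (B.letter X.mod Y.mod f ⊙ B.wpow X.mod X.δ i)

theorem b1_eq_finsum (f : X.Amb Y) :
    b1 f = ∑ᶠ i : ℕ × ℕ, B.bAd X.mod Y.mod (insWord f i.1 i.2) := rfl

theorem insWord_support (f : X.Amb Y) :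
    (Function.support fun i : ℕ × ℕ => B.bAd X.mod Y.mod (insWord f i.1 i.2)).Finite := by
  obtain ⟨N, hN⟩ := X.exists_wpow_eq_zero
  obtain ⟨M, hM⟩ := Y.exists_wpow_eq_zero
  refine (Finset.range N ×ˢ Finset.range M).finite_toSet.subset fun i hi => ?_
  by_contra hcon
  refine hi ?_
  simp only [Finset.coe_product, Set.mem_prod, Finset.mem_coe, Finset.mem_range, not_and_or,
    not_lt] at hcon
  rcases hcon with h | h
  · simp [insWord, hN _ h]
  · simp [insWord, hM _ h]

theorem b1_eq_sum {N : ℕ} (hX : B.wpow X.mod X.δ N = 0) (hY : B.wpow Y.mod Y.δ N = 0)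
    (f : X.Amb Y) :
    b1 f = ∑ j ∈ Finset.range N, ∑ i ∈ Finset.range N, B.bAd X.mod Y.mod (insWord f i j) := by
  rw [b1_eq_finsum, finsum_eq_sum_of_support_subset (s := Finset.range N ×ˢ Finset.range N),
    Finset.sum_product_right]
  intro i hi
  by_contra hcon
  refine hi ?_
  simp only [Finset.coe_product, Set.mem_prod, Finset.mem_coe, Finset.mem_range, not_and_or,
    not_lt] at hcon
  rcases hcon with h | h
  · simp [insWord, wpow_eq_zero_of_le hX h]
  · simp [insWord, wpow_eq_zero_of_le hY h]

theorem finsum_wpow {X : FSMod.{uk, uS, uP, uX} k e} {δ : B.Amb X X} {N : ℕ}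
    (hN : B.wpow X δ N = 0) :
    ∑ᶠ s : ℕ, B.bAd X X (B.wpow X δ (s + 1)) =
      ∑ s ∈ Finset.range N, B.bAd X X (B.wpow X δ (s + 1)) := by
  refine finsum_eq_sum_of_support_subset _ fun i hi => ?_
  by_contra hcon
  refine hi ?_
  simp only [Finset.coe_range, Set.mem_Iio, not_lt] at hcon
  beta_reduce
  rw [wpow_eq_zero_of_le hN (by omega), map_zero]

theorem maurerCartan_sum (X : TwObj.{uk, uS, uP, uZ, uX} B) {N : ℕ}
    (hX : B.wpow X.mod X.δ N = 0) :
    ∑ s ∈ Finset.range N, B.bAd X.mod X.mod (B.wpow X.mod X.δ (s + 1)) = 0 := by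
  rw [← finsum_wpow hX, X.maurerCartan]

theorem insWord_add (f g : X.Amb Y) (i j : ℕ) :
    insWord (f + g) i j = insWord f i j + insWord g i j := by
  simp [insWord]

theorem b1_add (f g : X.Amb Y) : b1 (f + g) = b1 f + b1 g := by
  rw [b1_eq_finsum, b1_eq_finsum, b1_eq_finsum, ← finsum_add_distrib (insWord_support f)
    (insWord_support g)]
  simp [insWord_add]

theorem b1_neg (f : X.Amb Y) : (b1 (-f) : X.Amb Y) = -b1 f :=
  (AddMonoidHom.mk' (b1 : X.Amb Y → X.Amb Y) b1_add).map_neg f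

/-- `b_1^{tw}(α f) = α b_1^{tw}(f)` for a linear map `α` that commutes with the `δ`'s. -/
theorem b1_post (α : Y.mod.carrier →ₗ[k] W.mod.carrier)
    (hα : (post α Y.δ : Y.Amb W) = pre α W.δ) (f : X.Amb Y) :
    (b1 (post α f : X.Amb W) : X.Amb W) = post α (b1 f) := by
  rw [b1_eq_finsum, b1_eq_finsum, map_finsum _ (insWord_support f)]
  refine finsum_congr fun i => ?_
  rw [← bAd_post, insWord, insWord, letter_post, wcomp_post_left,
    ← wcomp_pre_left, ← post_wpow α hα, wcomp_post_left]

/-- `b_1^{tw}(f β) = b_1^{tw}(f) β` for a linear map `β` that commutes with the `δ`'s. -/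
theorem b1_pre (β : W.mod.carrier →ₗ[k] X.mod.carrier)
    (hβ : (post β W.δ : W.Amb X) = pre β X.δ) (f : X.Amb Y) :
    (b1 (pre β f : W.Amb Y) : W.Amb Y) = pre β (b1 f) := by
  rw [b1_eq_finsum, b1_eq_finsum, map_finsum _ (insWord_support f)]
  refine finsum_congr fun i => ?_
  rw [← bAd_pre, insWord, insWord, letter_pre, wcomp_pre_left,
    post_wpow β hβ, wcomp_pre_right, wcomp_pre_right]

end TwObj

end Words

/-! ### Composable words of directed homogeneous elements -/

section Directed

variable {k : Type uk} {S : Type uS} {P : Type uP} [Field k] [NonUnitalRing S]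
  [Module k S] {e : P → S} {B : BAlgebra.{uk, uS, uP, uZ} k e}

/-- Concatenation of words. -/
local notation:70 w " ⊙ " v:71 => BAlgebra.wcomp _ _ _ _ w v

namespace BAlgebra

/-- The word `a_p a_{p+1} ⋯ a_{p+n-1}` in the tensor algebra. -/
def tword (B : BAlgebra.{uk, uS, uP, uZ} k e) (a : ℕ → B.carrier) (p n : ℕ) :
    TensorAlgebra k B.carrier :=
  TensorAlgebra.tprod k B.carrier n fun i => a (p + i)

theorem bTot_tword (a : ℕ → B.carrier) (p n : ℕ) :
    B.bTot (B.tword a p n) = B.b n fun i => a (p + i) :=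
  B.bTot_tprod n _

theorem tword_zero (a : ℕ → B.carrier) (p : ℕ) : B.tword a p 0 = 1 := by
  simp [tword, TensorAlgebra.tprod_apply]

theorem tword_one (a : ℕ → B.carrier) (p : ℕ) :
    B.tword a p 1 = TensorAlgebra.ι k (a p) := by
  simp [tword, TensorAlgebra.tprod_apply]

theorem tword_add (a : ℕ → B.carrier) (p m n : ℕ) :
    B.tword a p (m + n) = B.tword a p m * B.tword a (p + m) n := by
  simp [tword, TensorAlgebra.tprod_apply, List.ofFn_add, add_assoc]

theorem tword_congr {a a' : ℕ → B.carrier} {p p' n : ℕ}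
    (h : ∀ i < n, a (p + i) = a' (p' + i)) : B.tword a p n = B.tword a' p' n := by
  unfold tword
  congr 1
  funext i
  exact h i i.2

theorem bTot_ι_mul_ι (a b : B.carrier) :
    B.bTot (TensorAlgebra.ι k a * TensorAlgebra.ι k b) = B.b 2 ![a, b] := by
  rw [← B.bTot_tprod, TensorAlgebra.tprod_apply]
  simp

variable (unit : P → B.carrier)

/-- The span of the words `f ⊗ a_0 ⋯ a_{n-1}` with composable homogeneous directed letters
`a_i ∈ e_{w_i} Z e_{w_{i+1}}` of total degree `q`, and `f ∈ Hom(X e_{w_n}, Y e_{w_0})`.  When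
`p` holds, some letter is moreover required to be one of the units. -/
def dirWord (p : Prop) (X Y : FSMod.{uk, uS, uP, uX} k e) (n : ℕ) (q : ℤ) :
    Submodule k (B.Word X Y) :=
  Submodule.span k {x | ∃ (f : X.carrier →ₗ[k] Y.carrier) (w : ℕ → P) (a : ℕ → B.carrier)
    (d : ℕ → ℤ), Y.act (e (w 0)) ∘ₗ f ∘ₗ X.act (e (w n)) = f ∧
      (∀ i < n, a i ∈ B.dir (w i) (w (i + 1)) ⊓ B.deg (d i)) ∧
      ∑ i ∈ Finset.range n, d i = q ∧ (p → ∃ i < n, ∃ u, a i = unit u) ∧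
      x = f ⊗ₜ[k] B.tword a 0 n}

variable {unit}

variable {X Y W V : FSMod.{uk, uS, uP, uX} k e}

theorem letter_mem_dirWord {q : ℤ} {t : B.Amb X Y} (ht : t ∈ B.adDeg X Y q) :
    B.letter X Y t ∈ dirWord unit False X Y 1 q := by
  induction ht using Submodule.span_induction with
  | zero => simp
  | add x y _ _ hx hy => rw [map_add]; exact add_mem hx hy
  | smul c x _ hx => rw [map_smul]; exact Submodule.smul_mem _ _ hx
  | mem x hx =>
    obtain ⟨u, v, f, a, hf, ha, rfl⟩ := hx
    refine Submodule.subset_span ⟨f, fun i => if i = 0 then v else u, fun _ => a, fun _ => q,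
      by simpa using hf, ?_, by simp, by simp, by rw [tword_one]; rfl⟩
    intro i hi
    obtain rfl : i = 0 := by omega
    simpa using ha

theorem post_mem_adDeg (α : Y.Hom W) {q : ℤ} {t : B.Amb X Y} (ht : t ∈ B.adDeg X Y q) :
    post α.toLin t ∈ B.adDeg X W q := by
  induction ht using Submodule.span_induction with
  | zero => simp
  | add x y _ _ hx hy => rw [map_add]; exact add_mem hx hy
  | smul c x _ hx => rw [map_smul]; exact Submodule.smul_mem _ _ hx
  | mem x hx =>
    obtain ⟨u, v, f, a, hf, ha, rfl⟩ := hx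
    refine Submodule.subset_span ⟨u, v, α.toLin ∘ₗ f, a, ?_, ha, rfl⟩
    conv_rhs => rw [← hf, ← LinearMap.comp_assoc, α.comp_act]
    rfl

theorem pre_mem_adDeg (β : X.Hom Y) {q : ℤ} {t : B.Amb Y W} (ht : t ∈ B.adDeg Y W q) :
    pre β.toLin t ∈ B.adDeg X W q := by
  induction ht using Submodule.span_induction with
  | zero => simp
  | add x y _ _ hx hy => rw [map_add]; exact add_mem hx hy
  | smul c x _ hx => rw [map_smul]; exact Submodule.smul_mem _ _ hx
  | mem x hx =>
    obtain ⟨u, v, f, a, hf, ha, rfl⟩ := hx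
    refine Submodule.subset_span ⟨u, v, f ∘ₗ β.toLin, a, ?_, ha, rfl⟩
    conv_rhs => rw [← hf]
    rw [LinearMap.comp_assoc, LinearMap.comp_assoc, LinearMap.comp_assoc, β.comp_act]

/-- For `n ≠ 2` the operation `b_n^{ad}` vanishes on the words of length `n` that contain a strict
unit. -/
theorem bAd_eq_zero (hunit : B.IsStrictUnits unit) {n : ℕ} (hn : 1 ≤ n) (hn2 : n ≠ 2) {q : ℤ}
    {p : Prop} (hp : p) {x : B.Word X Y} (hx : x ∈ dirWord unit p X Y n q) : B.bAd X Y x = 0 := by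
  induction hx using Submodule.span_induction with
  | zero => simp
  | add x y _ _ hx hy => rw [map_add, hx, hy, add_zero]
  | smul c x _ hx => rw [map_smul, hx, smul_zero]
  | mem x hx =>
    obtain ⟨f, w, a, d, hf, ha, hd, hu, rfl⟩ := hx
    obtain ⟨i, hi, u, hiu⟩ := hu hp
    rw [bAd_tmul, bTot_tword, (hunit.strict u).2 n hn hn2 w _
      (fun j => by simpa using (ha j j.2).1) ⟨⟨i, hi⟩, by simpa using hiu⟩]
    simp

variable [IsScalarTower k S S] [SMulCommClass k S S]

/-- Directed words concatenate: if the end of the first is not the start of the second, the linear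
maps compose to zero. -/
theorem wcomp_mem_dirWord (hS : IsElementary k e) {p p' : Prop} {m n : ℕ} {q r : ℤ}
    {x : B.Word Y W} {y : B.Word X Y} (hx : x ∈ dirWord unit p Y W m q)
    (hy : y ∈ dirWord unit p' X Y n r) :
    x ⊙ y ∈ dirWord unit (p ∨ p') X W (m + n) (q + r) := by
  induction hx using Submodule.span_induction with
  | zero => simp
  | add x y _ _ hx hy => rw [map_add]; exact add_mem hx hy
  | smul c x _ hx => rw [map_smul]; exact Submodule.smul_mem _ _ hx
  | mem x hx =>
    obtain ⟨f, w, a, d, hf, ha, hd, hu, rfl⟩ := hx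
    induction hy using Submodule.span_induction with
    | zero => simp
    | add x y _ _ hx hy => rw [map_add]; exact add_mem hx hy
    | smul c x _ hx => rw [map_smul]; exact Submodule.smul_mem _ _ hx
    | mem y hy =>
      obtain ⟨g, v, b, d', hg, hb, hd', hu', rfl⟩ := hy
      rw [wcomp_tmul]
      by_cases hwv : w m = v 0
      · refine Submodule.subset_span ⟨f ∘ₗ g, fun i => if i < m then w i else v (i - m),
          fun i => if i < m then a i else b (i - m), fun i => if i < m then d i else d' (i - m),
          ?_, ?_, ?_, ?_, ?_⟩
        · have h0 : (if 0 < m then w 0 else v (0 - m)) = w 0 := by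
            rcases Nat.eq_zero_or_pos m with rfl | hm
            · simpa using hwv.symm
            · simp [hm]
          have h1 : (if m + n < m then w (m + n) else v (m + n - m)) = v n := by
            simp
          beta_reduce
          rw [h0, h1]
          conv_rhs => rw [← hf, ← hg]
          conv_lhs => rw [← hf, ← hg]
          ext z
          simp only [LinearMap.comp_apply, FSMod.act_act_self hS]
        · intro i hi
          by_cases him : i < m
          · have : (if i + 1 < m then w (i + 1) else v (i + 1 - m)) = w (i + 1) := by
              split_ifs with h
              · rfl
              · obtain rfl : i + 1 = m := by omega
                simp [hwv]
            simp only [him, if_true, this]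
            exact ha i him
          · have h1 : ¬ i + 1 < m := by omega
            have h2 : i + 1 - m = i - m + 1 := by omega
            simp only [him, h1, if_false, h2]
            exact hb _ (by omega)
        · rw [Finset.sum_range_add, ← hd, ← hd']
          congr 1
          · exact Finset.sum_congr rfl fun i hi => by simp [Finset.mem_range.1 hi]
          · exact Finset.sum_congr rfl fun i hi => by simp
        · rintro (h | h)
          · obtain ⟨i, hi, u, hiu⟩ := hu h
            exact ⟨i, by omega, u, by simp [hi, hiu]⟩
          · obtain ⟨i, hi, u, hiu⟩ := hu' h
            exact ⟨m + i, by omega, u, by simp [hiu]⟩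
        · rw [tword_add]
          congr 2
          · exact tword_congr fun i hi => by simp [hi]
          · exact tword_congr fun i hi => by simp
      · have : f ∘ₗ g = 0 := by
          rw [← hf, ← hg]
          ext z
          simp [FSMod.act_act_of_ne hS Y hwv]
        simp [this]

theorem one_mem_dirWord (hS : IsElementary k e) (X : FSMod.{uk, uS, uP, uX} k e) :
    ((LinearMap.id ⊗ₜ[k] 1 : B.Word X X)) ∈ dirWord unit False X X 0 0 := by
  rw [← X.sum_act hS, TensorProduct.sum_tmul]
  refine Submodule.sum_mem _ fun u _ => Submodule.subset_span
    ⟨X.act (e u), fun _ => u, fun _ => 0, fun _ => 0, ?_, ?_, ?_, ?_, ?_⟩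
  · rw [X.act_comp_self hS, X.act_comp_self hS]
  · simp
  · simp
  · simp
  · rw [tword_zero]

theorem wpow_mem_dirWord (hS : IsElementary k e) {δ : B.Amb X X} (hδ : δ ∈ B.adDeg X X 0)
    (n : ℕ) : B.wpow X δ n ∈ dirWord unit False X X n 0 := by
  induction n with
  | zero => exact one_mem_dirWord hS X
  | succ n ih =>
    have := wcomp_mem_dirWord hS (letter_mem_dirWord (unit := unit) hδ) ih
    rwa [or_self, add_comm 1 n, add_zero] at this

theorem lact_of_mem_dir (hS : IsElementary k e) {u v : P} {a : B.carrier} (ha : a ∈ B.dir v u) :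
    B.lact (e v) a = a := by
  obtain ⟨a, rfl⟩ := ha
  rw [LinearMap.comp_apply, ← B.lact_mul, hS.idem]

theorem ract_of_mem_dir (hS : IsElementary k e) {u v : P} {a : B.carrier} (ha : a ∈ B.dir v u) :
    B.ract (e u) a = a := by
  obtain ⟨a, rfl⟩ := ha
  rw [LinearMap.comp_apply, B.lact_ract, ← B.ract_mul, hS.idem]

/-- The operations `b_n` are morphisms of bimodules, so the value on a composable sequence is again
directed. -/
theorem b_mem_dir (hS : IsElementary k e) {n : ℕ} {w : ℕ → P} {a : Fin (n + 1) → B.carrier}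
    (ha : ∀ i : Fin (n + 1), a i ∈ B.dir (w i) (w (i + 1))) :
    B.b (n + 1) a ∈ B.dir (w 0) (w (n + 1)) := by
  have h0 := B.b_left n a (e (w 0))
  have h1 := B.b_right n a (e (w (n + 1)))
  rw [lact_of_mem_dir hS (by simpa using ha 0), Function.update_eq_self] at h0
  rw [ract_of_mem_dir hS (by simpa using ha (Fin.last n)), Function.update_eq_self] at h1
  exact ⟨B.b (n + 1) a, by rw [LinearMap.comp_apply, ← h1, ← h0]⟩

theorem bAd_mem_adDeg (hS : IsElementary k e) {p : Prop} {n : ℕ} (hn : 1 ≤ n) {q : ℤ}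
    {x : B.Word X Y} (hx : x ∈ dirWord unit p X Y n q) : B.bAd X Y x ∈ B.adDeg X Y (q + 1) := by
  induction hx using Submodule.span_induction with
  | zero => simp
  | add x y _ _ hx hy => rw [map_add]; exact add_mem hx hy
  | smul c x _ hx => rw [map_smul]; exact Submodule.smul_mem _ _ hx
  | mem x hx =>
    obtain ⟨f, w, a, d, hf, ha, hd, hu, rfl⟩ := hx
    obtain ⟨n, rfl⟩ := Nat.exists_eq_add_of_le' hn
    rw [bAd_tmul, bTot_tword]
    refine Submodule.subset_span ⟨w (n + 1), w 0, f, _, hf, ⟨?_, ?_⟩, rfl⟩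
    · exact b_mem_dir hS fun i => by simpa using (ha i i.2).1
    · rw [← hd, Finset.sum_range]
      exact B.b_deg (n + 1) hn (fun i => d i) _ fun i => by simpa using (ha i i.2).2

end BAlgebra

end Directed

/-! ### Special morphisms -/

section Lift

variable {k : Type uk} {S : Type uS} {P : Type uP} [Field k] [NonUnitalRing S]
  [Module k S] {e : P → S} {B : BAlgebra.{uk, uS, uP, uZ} k e} {unit : P → B.carrier}

/-- Concatenation of words. -/
local notation:70 w " ⊙ " v:71 => BAlgebra.wcomp _ _ _ _ w v

namespace TwObj

open BAlgebra

variable {X Y W V : TwObj.{uk, uS, uP, uZ, uX} B}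

theorem lift_eq_sum (φ : X.mod.Hom Y.mod) :
    (lift unit φ : X.Amb Y) = ∑ u ∈ X.mod.supp, (φ.toLin ∘ₗ X.mod.act (e u)) ⊗ₜ[k] unit u := by
  refine finsum_eq_sum_of_support_subset _ fun u hu => ?_
  by_contra h
  exact hu (by simp [X.mod.act_eq_zero_of_notMem h])

theorem post_lift (ψ : Y.mod.Hom W.mod) (φ : X.mod.Hom Y.mod) :
    post ψ.toLin (lift unit φ : X.Amb Y) = (lift unit (ψ.comp φ) : X.Amb W) := by
  rw [lift_eq_sum, lift_eq_sum, map_sum]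
  rfl

theorem unit_mem_dir (hunit : B.IsStrictUnits unit) (u : P) : unit u ∈ B.dir u u :=
  ⟨unit u, (hunit.dir u).symm⟩

theorem pre_lift (ψ : Y.mod.Hom W.mod) (φ : X.mod.Hom Y.mod) :
    pre φ.toLin (lift unit ψ : Y.Amb W) = (lift unit (ψ.comp φ) : X.Amb W) := by
  classical
  have h : ∀ (Z W : TwObj.{uk, uS, uP, uZ, uX} B) (χ : Z.mod.Hom W.mod) (s : Finset P),
      Z.mod.supp ⊆ s →
      (lift unit χ : Z.Amb W) = ∑ u ∈ s, (χ.toLin ∘ₗ Z.mod.act (e u)) ⊗ₜ[k] unit u := by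
    intro Z W χ s hs
    rw [lift_eq_sum]
    refine Finset.sum_subset hs fun u _ hu => ?_
    simp [Z.mod.act_eq_zero_of_notMem hu]
  rw [h _ _ ψ (X.mod.supp ∪ Y.mod.supp) Finset.subset_union_right,
    h _ _ (ψ.comp φ) (X.mod.supp ∪ Y.mod.supp) Finset.subset_union_left, map_sum]
  refine Finset.sum_congr rfl fun u _ => ?_
  rw [pre_tmul, LinearMap.comp_assoc, ← φ.comp_act]
  rfl

variable [IsScalarTower k S S] [SMulCommClass k S S]

theorem lift_injective (hS : IsElementary k e) (hunit : B.IsStrictUnits unit)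
    {φ ψ : X.mod.Hom Y.mod} (h : (lift unit φ : X.Amb Y) = lift unit ψ) : φ = ψ := by
  -- the component at `v` is recovered by applying `e_v` and a linear form that is nonzero on `𝔢_v`
  have key : ∀ (χ : X.mod.Hom Y.mod) (v : P) (φ' : B.carrier →ₗ[k] k),
      contract φ' (LinearMap.lTensor _ (B.lact (e v)) (lift unit χ : X.Amb Y))
        = φ' (unit v) • (χ.toLin ∘ₗ X.mod.act (e v)) := by
    intro χ v φ'
    rw [lift_eq_sum, map_sum, map_sum, Finset.sum_eq_single v]
    · rw [LinearMap.lTensor_tmul, contract_tmul, hunit.dir v, ← B.lact_mul, hS.idem, ← hunit.dir v]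
    · intro u _ hu
      rw [LinearMap.lTensor_tmul, contract_tmul, hunit.dir u, ← B.lact_mul, hS.orth v u hu.symm]
      simp
    · intro hv
      simp [X.mod.act_eq_zero_of_notMem hv]
  refine FSMod.Hom.ext (X.mod.hom_ext_act hS fun v => ?_)
  obtain ⟨φ', hφ'⟩ : ∃ φ' : B.carrier →ₗ[k] k, φ' (unit v) ≠ 0 := by
    by_contra! hcon
    exact hunit.ne_zero v ((Module.forall_dual_apply_eq_zero_iff k _).1 hcon)
  have := key φ v φ'
  rw [h, key ψ v φ'] at this
  exact (smul_right_injective _ hφ' this).symm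

theorem lift_mem_adDeg (hS : IsElementary k e) (hunit : B.IsStrictUnits unit)
    (φ : X.mod.Hom Y.mod) : (lift unit φ : X.Amb Y) ∈ B.adDeg X.mod Y.mod (-1) := by
  rw [lift_eq_sum]
  refine Submodule.sum_mem _ fun u _ => Submodule.subset_span
    ⟨u, u, φ.toLin ∘ₗ X.mod.act (e u), _, ?_, ⟨unit_mem_dir hunit u, hunit.deg u⟩, rfl⟩
  ext x
  simp only [LinearMap.comp_apply, ← φ.map_act, X.mod.act_act_self hS]

theorem letter_lift_mem_dirWord (hS : IsElementary k e) (hunit : B.IsStrictUnits unit)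
    (φ : X.mod.Hom Y.mod) :
    B.letter X.mod Y.mod (lift unit φ : X.Amb Y) ∈ dirWord unit True X.mod Y.mod 1 (-1) := by
  rw [lift_eq_sum, map_sum]
  refine Submodule.sum_mem _ fun u _ => Submodule.subset_span
    ⟨φ.toLin ∘ₗ X.mod.act (e u), fun _ => u, fun _ => unit u, fun _ => -1, ?_,
      fun _ _ => ⟨unit_mem_dir hunit u, hunit.deg u⟩, by simp, fun _ => ⟨0, by simp, u, rfl⟩,
      by rw [tword_one]; rfl⟩
  ext x
  simp only [LinearMap.comp_apply, ← φ.map_act, X.mod.act_act_self hS]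

theorem bAd_lift_wcomp (hS : IsElementary k e) (hunit : B.IsStrictUnits unit)
    (ψ : Y.mod.Hom W.mod) {q : ℤ} {t : X.Amb Y} (ht : t ∈ B.adDeg X.mod Y.mod q) :
    B.bAd X.mod W.mod (B.letter Y.mod W.mod (lift unit ψ : Y.Amb W) ⊙ B.letter X.mod Y.mod t)
      = post ψ.toLin t := by
  induction ht using Submodule.span_induction with
  | zero => simp
  | add x y _ _ hx hy => simp only [map_add, hx, hy]
  | smul c x _ hx => simp only [map_smul, hx]
  | mem x hx =>
    obtain ⟨u, v, f, a, hf, ha, rfl⟩ := hx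
    rw [lift_eq_sum]
    simp only [map_sum, LinearMap.sum_apply, letter_tmul, wcomp_tmul, bAd_tmul, bTot_ι_mul_ι,
      post_tmul]
    rw [Finset.sum_eq_single v]
    · rw [hunit.left_unit v q a ha.2, lact_of_mem_dir hS ha.1, ← hf]
      congr 1
      ext x
      simp only [LinearMap.comp_apply, Y.mod.act_act_self hS]
    · intro w _ hw
      have : (ψ.toLin ∘ₗ Y.mod.act (e w)) ∘ₗ f = 0 := by
        rw [← hf]
        ext x
        simp [Y.mod.act_act_of_ne hS hw]
      rw [this, TensorProduct.zero_tmul]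
    · intro hv
      rw [Y.mod.act_eq_zero_of_notMem hv]
      simp

theorem bAd_wcomp_lift (hS : IsElementary k e) (hunit : B.IsStrictUnits unit)
    (φ : X.mod.Hom Y.mod) {q : ℤ} {t : Y.Amb W} (ht : t ∈ B.adDeg Y.mod W.mod q) :
    B.bAd X.mod W.mod (B.letter Y.mod W.mod t ⊙ B.letter X.mod Y.mod (lift unit φ : X.Amb Y))
      = (q + 1).negOnePow • (pre φ.toLin t : X.Amb W) := by
  induction ht using Submodule.span_induction with
  | zero => simp
  | add x y _ _ hx hy => simp only [map_add, LinearMap.add_apply, hx, hy, smul_add]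
  | smul c x _ hx => simp only [map_smul, LinearMap.smul_apply, hx, smul_comm]
  | mem x hx =>
    obtain ⟨u, v, f, a, hf, ha, rfl⟩ := hx
    rw [lift_eq_sum]
    simp only [map_sum, letter_tmul, wcomp_tmul, bAd_tmul, bTot_ι_mul_ι, pre_tmul]
    have hfw : ∀ w, f ∘ₗ φ.toLin ∘ₗ X.mod.act (e w) =
        (f ∘ₗ Y.mod.act (e w)) ∘ₗ φ.toLin := fun w => by
      rw [φ.comp_act, LinearMap.comp_assoc]
    rw [Finset.sum_eq_single u]
    · have : f ∘ₗ Y.mod.act (e u) = f := by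
        rw [← hf]
        ext x
        simp only [LinearMap.comp_apply, Y.mod.act_act_self hS]
      rw [hunit.right_unit u q a ha.2, ract_of_mem_dir hS ha.1, hfw, this, Units.smul_def,
        Units.smul_def, ← TensorProduct.tmul_smul]
    · intro w _ hw
      have : f ∘ₗ Y.mod.act (e w) = 0 := by
        rw [← hf]
        ext x
        simp [Y.mod.act_act_of_ne hS hw.symm]
      rw [hfw, this]
      simp
    · intro hu
      rw [X.mod.act_eq_zero_of_notMem hu]
      simp

/-- Composition with a special morphism on the left is composition with its linear map. -/
theorem star_lift_left (hS : IsElementary k e) (hunit : B.IsStrictUnits unit)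
    (ψ : Y.mod.Hom W.mod) {q : ℤ} {t : X.Amb Y} (ht : t ∈ B.adDeg X.mod Y.mod q) :
    star (lift unit ψ : Y.Amb W) t = post ψ.toLin t := by
  unfold star
  rw [finsum_eq_single _ (0, 0, 0)]
  · simp only [wpow_zero, one_wcomp, wcomp_one, bAd_lift_wcomp hS hunit ψ ht]
  · rintro ⟨i, j, l⟩ h
    refine bAd_eq_zero hunit (n := l + (1 + (j + (1 + i)))) (by omega) ?_
      (by simp : False ∨ (True ∨ (False ∨ (False ∨ False))))
      (wcomp_mem_dirWord hS (wpow_mem_dirWord hS W.δ_mem l)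
        (wcomp_mem_dirWord hS (letter_lift_mem_dirWord hS hunit ψ)
          (wcomp_mem_dirWord hS (wpow_mem_dirWord hS Y.δ_mem j)
            (wcomp_mem_dirWord hS (letter_mem_dirWord ht) (wpow_mem_dirWord hS X.δ_mem i)))))
    contrapose! h
    rw [Prod.mk.injEq, Prod.mk.injEq]
    omega

/-- Composition with a special morphism on the right is composition with its linear map. -/
theorem star_lift_right (hS : IsElementary k e) (hunit : B.IsStrictUnits unit)
    (φ : X.mod.Hom Y.mod) {t : Y.Amb W} (ht : t ∈ B.adDeg Y.mod W.mod (-1)) :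
    star t (lift unit φ : X.Amb Y) = pre φ.toLin t := by
  unfold star
  rw [finsum_eq_single _ (0, 0, 0)]
  · simp only [wpow_zero, one_wcomp, wcomp_one, bAd_wcomp_lift hS hunit φ ht]
    simp
  · rintro ⟨i, j, l⟩ h
    refine bAd_eq_zero hunit (n := l + (1 + (j + (1 + i)))) (by omega) ?_
      (by simp : False ∨ (False ∨ (False ∨ (True ∨ False))))
      (wcomp_mem_dirWord hS (wpow_mem_dirWord hS W.δ_mem l)
        (wcomp_mem_dirWord hS (letter_mem_dirWord ht)
          (wcomp_mem_dirWord hS (wpow_mem_dirWord hS Y.δ_mem j)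
            (wcomp_mem_dirWord hS (letter_lift_mem_dirWord hS hunit φ)
              (wpow_mem_dirWord hS X.δ_mem i)))))
    contrapose! h
    rw [Prod.mk.injEq, Prod.mk.injEq]
    omega

theorem b1_lift (hS : IsElementary k e) (hunit : B.IsStrictUnits unit) (φ : X.mod.Hom Y.mod) :
    b1 (lift unit φ : X.Amb Y) = post φ.toLin X.δ - pre φ.toLin Y.δ := by
  classical
  rw [b1_eq_finsum, finsum_eq_sum_of_support_subset (s := {(1, 0), (0, 1)}),
    Finset.sum_pair (by simp)]
  · simp only [insWord, wpow_zero, wpow_one, one_wcomp, wcomp_one,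
      bAd_lift_wcomp hS hunit φ X.δ_mem, bAd_wcomp_lift hS hunit φ Y.δ_mem]
    simp [sub_eq_add_neg]
  · rintro ⟨i, j⟩ h
    by_contra hij
    refine h (bAd_eq_zero hunit (n := j + (1 + i)) (by omega) ?_
      (by simp : False ∨ (True ∨ False))
      (wcomp_mem_dirWord hS (wpow_mem_dirWord hS Y.δ_mem j)
        (wcomp_mem_dirWord hS (letter_lift_mem_dirWord hS hunit φ)
          (wpow_mem_dirWord hS X.δ_mem i))))
    simp only [Finset.coe_insert, Finset.coe_singleton, Set.mem_insert_iff, Prod.mk.injEq,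
      Set.mem_singleton_iff] at hij
    omega

theorem b1_mem_adDeg (hS : IsElementary k e) {q r : ℤ} (hqr : q + 1 = r)
    {f : X.Amb Y} (hf : f ∈ B.adDeg X.mod Y.mod q) : b1 f ∈ B.adDeg X.mod Y.mod r := by
  subst hqr
  rw [b1_eq_finsum]
  refine finsum_induction (fun x => x ∈ B.adDeg X.mod Y.mod (q + 1)) (zero_mem _)
    (fun _ _ => add_mem) fun i => ?_
  have := bAd_mem_adDeg hS (n := i.2 + (1 + i.1)) (by omega)
    (wcomp_mem_dirWord hS (wpow_mem_dirWord (unit := fun _ => 0) hS Y.δ_mem i.2)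
        (wcomp_mem_dirWord hS (letter_mem_dirWord hf) (wpow_mem_dirWord hS X.δ_mem i.1)))
  rwa [add_zero, zero_add] at this

theorem isMor_lift_iff (hS : IsElementary k e) (hunit : B.IsStrictUnits unit)
    (φ : X.mod.Hom Y.mod) : IsMor (lift unit φ : X.Amb Y) ↔
      (post φ.toLin X.δ : X.Amb Y) = pre φ.toLin Y.δ := by
  rw [IsMor, b1_lift hS hunit, sub_eq_zero]
  exact and_iff_right (lift_mem_adDeg hS hunit φ)

end TwObj

end Lift

/-! ### Direct sums of modules -/

namespace FSMod

variable {k : Type uk} {S : Type uS} {P : Type uP} [Field k] [NonUnitalRing S]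
  [Module k S] {e : P → S}

/-- The direct sum of two modules. -/
def prod (X Y : FSMod.{uk, uS, uP, uX} k e) : FSMod.{uk, uS, uP, uX} k e where
  carrier := X.carrier × Y.carrier
  act :=
    { toFun := fun s => (X.act s).prodMap (Y.act s)
      map_add' := fun s t => by ext <;> simp
      map_smul' := fun c s => by ext <;> simp }
  act_mul s t x := by
    simp [X.act_mul, Y.act_mul]
  top := by
    rw [eq_top_iff]
    rintro ⟨x, y⟩ -
    have hx : x ∈ ⨆ u, LinearMap.range (X.act (e u)) := by rw [X.top]; trivial
    have hy : y ∈ ⨆ u, LinearMap.range (Y.act (e u)) := by rw [Y.top]; trivial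
    have hxy : ((x, y) : X.carrier × Y.carrier) = (x, 0) + (0, y) := by simp
    rw [hxy]
    refine add_mem ?_ ?_
    · clear hxy
      induction hx using Submodule.iSup_induction' with
      | mem u x hx =>
        obtain ⟨x, rfl⟩ := hx
        exact Submodule.mem_iSup_of_mem u ⟨(x, 0), by simp⟩
      | zero => exact zero_mem _
      | add a b _ _ ha hb => simpa using add_mem ha hb
    · clear hxy
      induction hy using Submodule.iSup_induction' with
      | mem u y hy =>
        obtain ⟨y, rfl⟩ := hy
        exact Submodule.mem_iSup_of_mem u ⟨(0, y), by simp⟩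
      | zero => exact zero_mem _
      | add a b _ _ ha hb => simpa using add_mem ha hb
  finite_support := by
    refine (X.finite_support.union Y.finite_support).subset fun u hu => ?_
    by_contra hcon
    simp only [Set.mem_union, Set.mem_ofPred_eq, not_or, not_not, LinearMap.range_eq_bot] at hcon
    refine hu (LinearMap.range_eq_bot.2 ?_)
    ext <;> simp [hcon.1, hcon.2]

/-- The inclusion of the first summand. -/
def inl (X Y : FSMod.{uk, uS, uP, uX} k e) : X.Hom (X.prod Y) where
  toLin := LinearMap.inl k X.carrier Y.carrier
  map_act s _ := Prod.ext rfl (map_zero (Y.act s)).symm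

/-- The inclusion of the second summand. -/
def inr (X Y : FSMod.{uk, uS, uP, uX} k e) : Y.Hom (X.prod Y) where
  toLin := LinearMap.inr k X.carrier Y.carrier
  map_act s _ := Prod.ext (map_zero (X.act s)).symm rfl

/-- The projection to the first summand. -/
def fst (X Y : FSMod.{uk, uS, uP, uX} k e) : (X.prod Y).Hom X where
  toLin := LinearMap.fst k X.carrier Y.carrier
  map_act _ _ := rfl

/-- The projection to the second summand. -/
def snd (X Y : FSMod.{uk, uS, uP, uX} k e) : (X.prod Y).Hom Y where
  toLin := LinearMap.snd k X.carrier Y.carrier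
  map_act _ _ := rfl

variable (X Y : FSMod.{uk, uS, uP, uX} k e)

theorem fst_inl : (fst X Y).toLin ∘ₗ (inl X Y).toLin = LinearMap.id := rfl

theorem snd_inr : (snd X Y).toLin ∘ₗ (inr X Y).toLin = LinearMap.id := rfl

theorem fst_inr : (fst X Y).toLin ∘ₗ (inr X Y).toLin = 0 := rfl

theorem snd_inl : (snd X Y).toLin ∘ₗ (inl X Y).toLin = 0 := rfl

theorem inl_fst_add_inr_snd : (inl X Y).toLin ∘ₗ (fst X Y).toLin +
    (inr X Y).toLin ∘ₗ (snd X Y).toLin = LinearMap.id :=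
  LinearMap.ext fun (x : X.carrier × Y.carrier) => Prod.ext (add_zero x.1) (zero_add x.2)

end FSMod

/-! ### The relations of the `b`-algebra on words -/

section Relation

variable {k : Type uk} {S : Type uS} {P : Type uP} [Field k] [NonUnitalRing S]
  [Module k S] {e : P → S} {B : BAlgebra.{uk, uS, uP, uZ} k e}

/-- Concatenation of words. -/
local notation:70 w " ⊙ " v:71 => BAlgebra.wcomp _ _ _ _ w v

namespace BAlgebra

variable {X Y W : FSMod.{uk, uS, uP, uX} k e}

variable (B X Y) in
/-- The elements of degree `q` of `Hom_k(X, Y) ⊗ Z`. -/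
def homDeg (q : ℤ) : Submodule k (B.Amb X Y) :=
  Submodule.span k {t | ∃ (f : X.carrier →ₗ[k] Y.carrier), ∃ a ∈ B.deg q, t = f ⊗ₜ[k] a}

theorem adDeg_le_homDeg (q : ℤ) : B.adDeg X Y q ≤ B.homDeg X Y q := by
  refine Submodule.span_mono ?_
  rintro _ ⟨u, v, f, a, -, ha, rfl⟩
  exact ⟨f, a, ha.2, rfl⟩

/-- The word `t_p ⊗ t_{p+1} ⊗ ⋯ ⊗ t_{p+n-1}`. -/
def lword (t : ℕ → B.Amb X X) : ℕ → ℕ → B.Word X X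
  | _, 0 => LinearMap.id ⊗ₜ[k] 1
  | p, n + 1 => B.letter X X (t p) ⊙ lword t (p + 1) n

theorem lword_zero (t : ℕ → B.Amb X X) (p : ℕ) : lword t p 0 = LinearMap.id ⊗ₜ[k] 1 := rfl

theorem lword_succ (t : ℕ → B.Amb X X) (p n : ℕ) :
    lword t p (n + 1) = B.letter X X (t p) ⊙ lword t (p + 1) n := rfl

theorem lword_add (t : ℕ → B.Amb X X) (p m n : ℕ) :
    lword t p (m + n) = lword t p m ⊙ lword t (p + m) n := by
  induction m generalizing p with
  | zero => rw [Nat.zero_add, lword_zero, one_wcomp, add_zero]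
  | succ m ih =>
    rw [Nat.succ_add, lword_succ, lword_succ, ih, wcomp_assoc, Nat.add_right_comm, add_assoc]

theorem lword_congr {t t' : ℕ → B.Amb X X} {p n : ℕ}
    (h : ∀ i, p ≤ i → i < p + n → t i = t' i) : lword t p n = lword t' p n := by
  induction n generalizing p with
  | zero => rfl
  | succ n ih =>
    rw [lword_succ, lword_succ, h p le_rfl (by omega),
      ih fun i hi hi' => h i (by omega) (by omega)]

theorem lword_eq_wpow {t : ℕ → B.Amb X X} {δ : B.Amb X X} {p n : ℕ}
    (h : ∀ i, p ≤ i → i < p + n → t i = δ) : lword t p n = B.wpow X δ n := by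
  induction n generalizing p with
  | zero => rfl
  | succ n ih =>
    rw [lword_succ, wpow_succ, h p le_rfl (by omega),
      ih fun i hi hi' => h i (by omega) (by omega)]

/-- A word is linear in each of its letters. -/
theorem isLinearMap_lword_update (t : ℕ → B.Amb X X) {m p n : ℕ} (h1 : p ≤ m) (h2 : m < p + n) :
    IsLinearMap k fun y => lword (Function.update t m y) p n := by
  induction n generalizing p with
  | zero => omega
  | succ n ih =>
    simp only [lword_succ]
    rcases eq_or_ne p m with rfl | hpm
    · have : ∀ y, lword (Function.update t p y) (p + 1) n = lword t (p + 1) n := fun y =>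
        lword_congr fun i hi _ => Function.update_of_ne (by omega) _ _
      simp only [this, Function.update_self]
      exact ((B.wcomp X X X).flip (lword t (p + 1) n) ∘ₗ B.letter X X).isLinear
    · have := ih (p := p + 1) (by omega) (by omega)
      simp only [Function.update_of_ne hpm]
      exact (B.wcomp X X X (B.letter X X (t p)) ∘ₗ this.mk' _).isLinear

/-- The composite `c_p c_{p+1} ⋯ c_{p+n-1}`. -/
def cprod (c : ℕ → X.carrier →ₗ[k] X.carrier) : ℕ → ℕ → X.carrier →ₗ[k] X.carrier
  | _, 0 => LinearMap.id
  | p, n + 1 => c p ∘ₗ cprod c (p + 1) n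

theorem cprod_add (c : ℕ → X.carrier →ₗ[k] X.carrier) (p m n : ℕ) :
    cprod c p (m + n) = cprod c p m ∘ₗ cprod c (p + m) n := by
  induction m generalizing p with
  | zero => rw [Nat.zero_add, cprod, LinearMap.id_comp, add_zero]
  | succ m ih =>
    rw [Nat.succ_add, cprod, cprod, ih, LinearMap.comp_assoc, Nat.add_right_comm, add_assoc]

theorem lword_tmul {t : ℕ → B.Amb X X} {c : ℕ → X.carrier →ₗ[k] X.carrier}
    {a : ℕ → B.carrier} {p n : ℕ} (h : ∀ i, p ≤ i → i < p + n → t i = c i ⊗ₜ[k] a i) :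
    lword t p n = cprod c p n ⊗ₜ[k] B.tword a p n := by
  induction n generalizing p with
  | zero => rw [lword_zero, tword_zero]; rfl
  | succ n ih =>
    rw [lword_succ, h p le_rfl (by omega), ih fun i hi hi' => h i (by omega) (by omega),
      letter_tmul, wcomp_tmul, add_comm n 1, tword_add, tword_one, add_comm 1 n]
    rfl

/-- The word `t_0 ⊗ ⋯ ⊗ t_{n-1}` with `b^{ad}` applied first to the `s` letters that start at `t_r`,
and then to the resulting word. -/
def relTerm (t : ℕ → B.Amb X X) (n r s : ℕ) : B.Amb X X :=
  B.bAd X X (lword t 0 r ⊙ (B.letter X X (B.bAd X X (lword t r s)) ⊙ lword t (r + s) (n - r - s)))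

theorem relTerm_tmul {t : ℕ → B.Amb X X} {c : ℕ → X.carrier →ₗ[k] X.carrier}
    {a : ℕ → B.carrier} {n r s : ℕ} (hrs : r + s ≤ n) (h : ∀ i, i < n → t i = c i ⊗ₜ[k] a i) :
    relTerm t n r s = cprod c 0 n ⊗ₜ[k] B.b (r + 1 + (n - r - s)) (fun i =>
          if (i : ℕ) < r then a i
          else if (i : ℕ) = r then B.b s (fun j => a (r + j))
          else a (i + s - 1)) := by
  obtain ⟨l, rfl⟩ := Nat.exists_eq_add_of_le hrs
  have hl : r + s + l - r - s = l := by omega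
  unfold relTerm
  rw [hl, lword_tmul fun i _ hi => h i (by omega), lword_tmul fun i _ hi => h i (by omega),
    lword_tmul fun i _ hi => h i (by omega), bAd_tmul, letter_tmul, wcomp_tmul, wcomp_tmul,
    bAd_tmul, cprod_add, cprod_add, LinearMap.comp_assoc, Nat.zero_add, Nat.zero_add]
  congr 1
  let a' : ℕ → B.carrier := fun i =>
    if i < r then a i else if i = r then B.b s (fun j => a (r + j)) else a (i + s - 1)
  have h1 : B.tword a 0 r = B.tword a' 0 r := tword_congr fun i hi => by simp [a', hi]
  have h2 : TensorAlgebra.ι k (B.bTot (B.tword a r s)) = B.tword a' r 1 := by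
    rw [tword_one, bTot_tword]
    simp [a']
  have h3 : B.tword a (r + s) l = B.tword a' (r + 1) l := tword_congr fun i _ => by
    have e1 : ¬ r + 1 + i < r := by omega
    have e2 : ¬ r + 1 + i = r := by omega
    have e3 : r + 1 + i + s - 1 = r + s + i := by omega
    simp only [a', e1, e2, e3, if_false]
  rw [h1, h2, h3, ← mul_assoc]
  have h4 := B.tword_add a' 0 r 1
  have h5 := B.tword_add a' 0 (r + 1) l
  rw [Nat.zero_add] at h4 h5
  rw [← h4, ← h5, bTot_tword]
  simp only [Nat.zero_add, a']

theorem isLinearMap_relTerm_update (t : ℕ → B.Amb X X) {m n r s : ℕ} (hrs : r + s ≤ n)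
    (hm : m < n) : IsLinearMap k fun y => relTerm (Function.update t m y) n r s := by
  have hc : ∀ p l, (m < p ∨ p + l ≤ m) → ∀ y, lword (Function.update t m y) p l = lword t p l :=
    fun p l h y => lword_congr fun i hi hi' => Function.update_of_ne (by omega) _ _
  unfold relTerm
  rcases lt_or_ge m r with h | h
  · have h1 := isLinearMap_lword_update t (Nat.zero_le m) (p := 0) (n := r) (by omega)
    simp only [hc r s (by omega), hc (r + s) (n - r - s) (by omega)]
    exact (B.bAd X X ∘ₗ (B.wcomp X X X).flip _ ∘ₗ h1.mk' _).isLinear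
  · rcases lt_or_ge m (r + s) with h' | h'
    · have h1 := isLinearMap_lword_update t h h'
      simp only [hc 0 r (by omega), hc (r + s) (n - r - s) (by omega)]
      exact (B.bAd X X ∘ₗ B.wcomp X X X (lword t 0 r) ∘ₗ
        (B.wcomp X X X).flip (lword t (r + s) (n - r - s)) ∘ₗ B.letter X X ∘ₗ B.bAd X X ∘ₗ
        h1.mk' _).isLinear
    · have h1 := isLinearMap_lword_update t h' (n := n - r - s) (by omega)
      simp only [hc 0 r (by omega), hc r s (by omega)]
      exact (B.bAd X X ∘ₗ B.wcomp X X X (lword t 0 r) ∘ₗ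
        B.wcomp X X X (B.letter X X (B.bAd X X (lword t r s))) ∘ₗ h1.mk' _).isLinear

/-- The relations of the `b`-algebra hold for `b^{ad}`, because they are multilinear. -/
theorem sum_relTerm {n : ℕ} (hn : 1 ≤ n) (d : ℕ → ℤ) (t : ℕ → B.Amb X X)
    (ht : ∀ i, t i ∈ B.homDeg X X (d i)) :
    ∑ r ∈ Finset.range n, ∑ s ∈ Finset.Icc 1 (n - r),
      (∑ i ∈ Finset.range r, d i).negOnePow • relTerm t n r s = 0 := by
  -- the letters from the `m`-th on may be assumed to be pure tensors; induction on `m`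
  suffices key : ∀ (m : ℕ) (t : ℕ → B.Amb X X), (∀ i, t i ∈ B.homDeg X X (d i)) →
      (∀ i, m ≤ i → i < n → ∃ (c : X.carrier →ₗ[k] X.carrier), ∃ a ∈ B.deg (d i),
        t i = c ⊗ₜ[k] a) →
      ∑ r ∈ Finset.range n, ∑ s ∈ Finset.Icc 1 (n - r),
        (∑ i ∈ Finset.range r, d i).negOnePow • relTerm t n r s = 0 from
    key n t ht fun i h h' => absurd h (not_le.2 h')
  clear ht t
  intro m
  induction m with
  | zero =>
    intro t _ hp
    have : ∀ i, ∃ (c : X.carrier →ₗ[k] X.carrier) (a : B.carrier), a ∈ B.deg (d i) ∧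
        (i < n → t i = c ⊗ₜ[k] a) := by
      intro i
      by_cases hi : i < n
      · obtain ⟨c, a, ha, h⟩ := hp i (Nat.zero_le _) hi
        exact ⟨c, a, ha, fun _ => h⟩
      · exact ⟨0, 0, zero_mem _, fun h => absurd h hi⟩
    choose c a ha hca using this
    have hrel := congrArg (TensorProduct.mk k _ _ (cprod c 0 n)) (B.b_rel n hn d a ha)
    rw [map_zero] at hrel
    rw [← hrel, map_sum]
    refine Finset.sum_congr rfl fun r hr => ?_
    rw [map_sum]
    refine Finset.sum_congr rfl fun s hs => ?_
    rw [Finset.mem_range] at hr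
    rw [Finset.mem_Icc] at hs
    rw [relTerm_tmul (by omega) hca, Units.smul_def, Units.smul_def, map_zsmul]
    rfl
  | succ m ih =>
    intro t ht hp
    rcases lt_or_ge m n with hm | hm
    · have hlin : ∀ r ∈ Finset.range n, ∀ s ∈ Finset.Icc 1 (n - r),
          IsLinearMap k fun y => relTerm (Function.update t m y) n r s := fun r hr s hs => by
        rw [Finset.mem_range] at hr
        rw [Finset.mem_Icc] at hs
        exact isLinearMap_relTerm_update t (by omega) hm
      have hmem := ht m
      rw [← Function.update_eq_self m t]
      generalize t m = y at hmem ⊢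
      have hsub : y ∈ B.homDeg X X (d m) := hmem
      induction hmem using Submodule.span_induction with
      | mem y hy =>
        refine ih _ (fun i => ?_) fun i hi hi' => ?_
        · rcases eq_or_ne i m with rfl | h
          · simpa using hsub
          · simpa [Function.update_of_ne h] using ht i
        · rcases eq_or_ne i m with rfl | h
          · simpa using hy
          · simpa [Function.update_of_ne h] using hp i (by omega) hi'
      | zero =>
        refine Finset.sum_eq_zero fun r hr => Finset.sum_eq_zero fun s hs => ?_
        rw [(hlin r hr s hs).map_zero, smul_zero]
      | add x y hx hy ihx ihy =>
        refine Eq.trans ?_ ((congrArg₂ (· + ·) (ihx hx) (ihy hy)).trans (add_zero 0))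
        rw [← Finset.sum_add_distrib]
        refine Finset.sum_congr rfl fun r hr => ?_
        rw [← Finset.sum_add_distrib]
        refine Finset.sum_congr rfl fun s hs => ?_
        rw [(hlin r hr s hs).map_add, smul_add]
      | smul c x hx ihx =>
        rw [← smul_zero c]
        conv_rhs => rw [← ihx hx]
        rw [Finset.smul_sum]
        refine Finset.sum_congr rfl fun r hr => ?_
        rw [Finset.smul_sum]
        refine Finset.sum_congr rfl fun s hs => ?_
        rw [(hlin r hr s hs).map_smul, smul_comm]
    · exact ih t ht fun i hi hi' => by omega

end BAlgebra

end Relation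

/-! ### The differential squares to zero -/

section Square

variable {k : Type uk} {S : Type uS} {P : Type uP} [Field k] [NonUnitalRing S]
  [Module k S] {e : P → S} {B : BAlgebra.{uk, uS, uP, uZ} k e}

/-- Concatenation of words. -/
local notation:70 w " ⊙ " v:71 => BAlgebra.wcomp _ _ _ _ w v

namespace BAlgebra

variable {X Y W : FSMod.{uk, uS, uP, uX} k e}

theorem post_mem_homDeg (α : Y.carrier →ₗ[k] W.carrier) {q : ℤ}
    {t : B.Amb X Y} (ht : t ∈ B.homDeg X Y q) : post α t ∈ B.homDeg X W q := by
  induction ht using Submodule.span_induction with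
  | zero => simp
  | add x y _ _ hx hy => rw [map_add]; exact add_mem hx hy
  | smul c x _ hx => rw [map_smul]; exact Submodule.smul_mem _ _ hx
  | mem x hx =>
    obtain ⟨f, a, ha, rfl⟩ := hx
    exact Submodule.subset_span ⟨α ∘ₗ f, a, ha, rfl⟩

theorem pre_mem_homDeg (β : X.carrier →ₗ[k] Y.carrier) {q : ℤ}
    {t : B.Amb Y W} (ht : t ∈ B.homDeg Y W q) : pre β t ∈ B.homDeg X W q := by
  induction ht using Submodule.span_induction with
  | zero => simp
  | add x y _ _ hx hy => rw [map_add]; exact add_mem hx hy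
  | smul c x _ hx => rw [map_smul]; exact Submodule.smul_mem _ _ hx
  | mem x hx =>
    obtain ⟨f, a, ha, rfl⟩ := hx
    exact Submodule.subset_span ⟨f ∘ₗ β, a, ha, rfl⟩

/-- The relations for the words `δ^{⊗ j} ⊗ f ⊗ δ^{⊗ i}`, with `δ` of degree `0` and `f` of degree
`-1`.  The inner operation acts on a power of `δ` to the left of `f`, or on a subword that contains
`f`, or on a power of `δ` to the right of `f`; only in the last case there is a sign. -/
theorem sum_relTerm_insert {δ f : B.Amb X X} (hδ : δ ∈ B.homDeg X X 0)
    (hf : f ∈ B.homDeg X X (-1)) (i j : ℕ) :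
    ∑ r ∈ Finset.range (j + 1 + i), ∑ s ∈ Finset.Icc 1 (j + 1 + i - r),
      ((if r + s ≤ j then B.bAd X X (B.wpow X δ r ⊙ (B.letter X X (B.bAd X X (B.wpow X δ s)) ⊙
          (B.wpow X δ (j - r - s) ⊙ (B.letter X X f ⊙ B.wpow X δ i)))) else 0) +
       (if r ≤ j ∧ j < r + s then B.bAd X X (B.wpow X δ r ⊙ (B.letter X X (B.bAd X X
          (B.wpow X δ (j - r) ⊙ (B.letter X X f ⊙ B.wpow X δ (r + s - 1 - j)))) ⊙
            B.wpow X δ (j + 1 + i - r - s))) else 0) -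
       (if j < r then B.bAd X X (B.wpow X δ j ⊙ (B.letter X X f ⊙ (B.wpow X δ (r - 1 - j) ⊙
          (B.letter X X (B.bAd X X (B.wpow X δ s)) ⊙ B.wpow X δ (j + 1 + i - r - s))))) else 0))
      = 0 := by
  let d : ℕ → ℤ := fun m => if m = j then -1 else 0
  let t : ℕ → B.Amb X X := fun m => if m = j then f else δ
  have ht : ∀ m, t m ∈ B.homDeg X X (d m) := by
    intro m
    by_cases h : m = j
    · simpa [t, d, h] using hf
    · simpa [t, d, h] using hδ
  have hout : ∀ p n, (j < p ∨ p + n ≤ j) → lword t p n = B.wpow X δ n := fun p n h =>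
    lword_eq_wpow fun m hm hm' => if_neg (by omega)
  have hin : ∀ p n, p ≤ j → j < p + n → lword t p n =
      B.wpow X δ (j - p) ⊙ (B.letter X X f ⊙ B.wpow X δ (p + n - 1 - j)) := by
    intro p n h h'
    have e1 : n = (j - p) + (1 + (p + n - 1 - j)) := by omega
    conv_lhs => rw [e1, lword_add, lword_add, lword_succ, lword_zero, wcomp_one]
    rw [hout _ _ (by omega), hout _ _ (by omega)]
    have : t (p + (j - p)) = f := if_pos (by omega)
    rw [this]
  refine Eq.trans ?_ (sum_relTerm (n := j + 1 + i) (by omega) d t ht)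
  refine Finset.sum_congr rfl fun r hr => Finset.sum_congr rfl fun s hs => ?_
  rw [Finset.mem_range] at hr
  rw [Finset.mem_Icc] at hs
  have hd : ∑ m ∈ Finset.range r, d m = if j < r then -1 else 0 := by
    simp [d, Finset.sum_ite_eq', Finset.mem_range]
  rw [hd]
  unfold relTerm
  rcases lt_or_ge j r with h1 | h1
  · rw [if_neg (by omega), if_neg (by omega), if_pos h1, if_pos h1, hin 0 r (by omega) (by omega),
      hout r s (by omega), hout (r + s) _ (by omega), wcomp_assoc, wcomp_assoc]
    simp
  · rw [if_neg (not_lt.2 h1), if_neg (not_lt.2 h1)]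
    rcases lt_or_ge j (r + s) with h2 | h2
    · rw [if_neg (by omega), if_pos ⟨h1, h2⟩, hout 0 r (by omega), hin r s h1 h2,
        hout (r + s) _ (by omega)]
      simp
    · rw [if_pos h2, if_neg (by omega), hout 0 r (by omega), hout r s (by omega),
        hin (r + s) _ h2 (by omega)]
      have e1 : j - (r + s) = j - r - s := by omega
      have e2 : r + s + (j + 1 + i - r - s) - 1 - j = i := by omega
      rw [e1, e2]
      simp

/-- If `δ` is nilpotent of degree `0` and satisfies the Maurer-Cartan equation, then
`f ↦ ∑ b^{ad}(δ^{⊗ j} ⊗ f ⊗ δ^{⊗ i})` squares to zero on elements of degree `-1`. -/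
theorem sum_bAd_insert_insert {δ f : B.Amb X X} (hδ : δ ∈ B.homDeg X X 0)
    (hf : f ∈ B.homDeg X X (-1)) {N : ℕ} (hN : B.wpow X δ N = 0)
    (hMC : ∑ s ∈ Finset.range N, B.bAd X X (B.wpow X δ (s + 1)) = 0) :
    ∑ a ∈ Finset.range N, ∑ c ∈ Finset.range N, B.bAd X X (B.wpow X δ a ⊙
      (B.letter X X (∑ q ∈ Finset.range N, ∑ p ∈ Finset.range N, B.bAd X X (B.wpow X δ q ⊙
        (B.letter X X f ⊙ B.wpow X δ p))) ⊙ B.wpow X δ c)) = 0 := by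
  classical
  have hz : ∀ n, ¬ n < N → B.wpow X δ n = 0 := fun n hn => wpow_eq_zero_of_le hN (not_lt.1 hn)
  let R := Finset.range N
  let R4 : Finset (ℕ × ℕ × ℕ × ℕ) := R ×ˢ R ×ˢ R ×ˢ R
  let fA : ℕ → ℕ → ℕ → ℕ → B.Amb X X := fun a s c i => B.bAd X X (B.wpow X δ a ⊙
    (B.letter X X (B.bAd X X (B.wpow X δ s)) ⊙
      (B.wpow X δ c ⊙ (B.letter X X f ⊙ B.wpow X δ i))))
  let fC : ℕ → ℕ → ℕ → ℕ → B.Amb X X := fun a q p c => B.bAd X X (B.wpow X δ a ⊙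
    (B.letter X X (B.bAd X X (B.wpow X δ q ⊙ (B.letter X X f ⊙ B.wpow X δ p))) ⊙ B.wpow X δ c))
  let fD : ℕ → ℕ → ℕ → ℕ → B.Amb X X := fun j a s c => B.bAd X X (B.wpow X δ j ⊙
    (B.letter X X f ⊙ (B.wpow X δ a ⊙ (B.letter X X (B.bAd X X (B.wpow X δ s)) ⊙ B.wpow X δ c))))
  have hA : ∀ a s c i, fA a s c i ≠ 0 → a < N ∧ s < N ∧ c < N ∧ i < N := by
    intro a s c i h
    refine ⟨?_, ?_, ?_, ?_⟩ <;> by_contra hn <;> exact h (by simp [fA, hz _ hn])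
  have hC : ∀ a q p c, fC a q p c ≠ 0 → a < N ∧ q < N ∧ p < N ∧ c < N := by
    intro a s c i h
    refine ⟨?_, ?_, ?_, ?_⟩ <;> by_contra hn <;> exact h (by simp [fC, hz _ hn])
  have hD : ∀ j a s c, fD j a s c ≠ 0 → j < N ∧ a < N ∧ s < N ∧ c < N := by
    intro a s c i h
    refine ⟨?_, ?_, ?_, ?_⟩ <;> by_contra hn <;> exact h (by simp [fD, hz _ hn])
  -- the words with at most `3 N` letters on each side of `f` account for all nonzero terms
  let Q := Finset.range (3 * N) ×ˢ Finset.range (3 * N)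
  let Ω : Finset (Σ _ : ℕ × ℕ, Σ _ : ℕ, ℕ) := Q.sigma fun x =>
    (Finset.range (x.2 + 1 + x.1)).sigma fun r => Finset.Icc 1 (x.2 + 1 + x.1 - r)
  have hΩ : ∀ i j r s, (⟨(i, j), r, s⟩ : Σ _ : ℕ × ℕ, Σ _ : ℕ, ℕ) ∈ Ω ↔
      (i < 3 * N ∧ j < 3 * N) ∧ r < j + 1 + i ∧ 1 ≤ s ∧ s ≤ j + 1 + i - r := by
    intro i j r s
    simp [Ω, Q]
  have htot : ∑ ω ∈ Ω, ((if ω.2.1 + ω.2.2 ≤ ω.1.2 then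
        fA ω.2.1 ω.2.2 (ω.1.2 - ω.2.1 - ω.2.2) ω.1.1 else 0) +
      (if ω.2.1 ≤ ω.1.2 ∧ ω.1.2 < ω.2.1 + ω.2.2 then
        fC ω.2.1 (ω.1.2 - ω.2.1) (ω.2.1 + ω.2.2 - 1 - ω.1.2)
          (ω.1.2 + 1 + ω.1.1 - ω.2.1 - ω.2.2) else 0) -
      (if ω.1.2 < ω.2.1 then
        fD ω.1.2 (ω.2.1 - 1 - ω.1.2) ω.2.2 (ω.1.2 + 1 + ω.1.1 - ω.2.1 - ω.2.2) else 0)) = 0 := by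
    rw [Finset.sum_sigma]
    refine Finset.sum_eq_zero fun x _ => ?_
    rw [Finset.sum_sigma]
    exact sum_relTerm_insert hδ hf x.1 x.2
  rw [Finset.sum_sub_distrib, Finset.sum_add_distrib] at htot
  have sA : ∑ ω ∈ Ω, (if ω.2.1 + ω.2.2 ≤ ω.1.2 then
        fA ω.2.1 ω.2.2 (ω.1.2 - ω.2.1 - ω.2.2) ω.1.1 else 0) = 0 := by
    have h1 : ∑ x ∈ R4, fA x.1 (x.2.2.2 + 1) x.2.1 x.2.2.1 = 0 := by
      simp only [R4, Finset.sum_product]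
      refine Finset.sum_eq_zero fun a _ => Finset.sum_eq_zero fun c _ =>
        Finset.sum_eq_zero fun i _ => ?_
      have : ∀ s, fA a (s + 1) c i = (B.bAd X X ∘ₗ B.wcomp X X X (B.wpow X δ a) ∘ₗ
        (B.wcomp X X X).flip (B.wpow X δ c ⊙ (B.letter X X f ⊙ B.wpow X δ i)) ∘ₗ B.letter X X)
          (B.bAd X X (B.wpow X δ (s + 1))) := fun s => rfl
      simp only [this]
      rw [← map_sum, hMC, map_zero]
    refine Eq.trans ?_ h1
    refine Finset.sum_bij_ne_zero
      (fun ω _ _ => (ω.2.1, ω.1.2 - ω.2.1 - ω.2.2, ω.1.1, ω.2.2 - 1)) ?_ ?_ ?_ ?_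
    · rintro ⟨⟨i, j⟩, r, s⟩ hω hne
      have hc := (ite_ne_right_iff.1 hne)
      have := hA _ _ _ _ hc.2
      simp only [R4, R, Finset.mem_product, Finset.mem_range]
      simp only [] at this
      omega
    · rintro ⟨⟨i, j⟩, r, s⟩ hω hne ⟨⟨i', j'⟩, r', s'⟩ hω' hne' h
      have hc := (ite_ne_right_iff.1 hne).1
      have hc' := (ite_ne_right_iff.1 hne').1
      rw [hΩ] at hω hω'
      simp only [Prod.mk.injEq] at h hc hc'
      obtain ⟨h1, h2, h3, h4⟩ := h
      obtain rfl := h1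
      obtain rfl := h3
      obtain rfl : s = s' := by omega
      obtain rfl : j = j' := by omega
      rfl
    · rintro ⟨a, c, i, s⟩ hx hne
      have := hA _ _ _ _ hne
      simp only [] at this
      have hmem : (⟨(i, a + (s + 1) + c), a, s + 1⟩ : Σ _ : ℕ × ℕ, Σ _ : ℕ, ℕ) ∈ Ω := by
        rw [hΩ]; omega
      have e1 : a + (s + 1) + c - a - (s + 1) = c := by omega
      refine ⟨_, hmem, ?_, ?_⟩
      · simp only [e1]
        rwa [if_pos (by omega)]
      · simp only [e1, Nat.add_sub_cancel]
    · rintro ⟨⟨i, j⟩, r, s⟩ hω hne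
      have hc := (ite_ne_right_iff.1 hne).1
      rw [hΩ] at hω
      rw [if_pos hc]
      simp only []
      rw [Nat.sub_add_cancel hω.2.2.1]
  have sD : ∑ ω ∈ Ω, (if ω.1.2 < ω.2.1 then
        fD ω.1.2 (ω.2.1 - 1 - ω.1.2) ω.2.2 (ω.1.2 + 1 + ω.1.1 - ω.2.1 - ω.2.2) else 0) = 0 := by
    have h1 : ∑ x ∈ R4, fD x.1 x.2.1 (x.2.2.2 + 1) x.2.2.1 = 0 := by
      simp only [R4, Finset.sum_product]
      refine Finset.sum_eq_zero fun j _ => Finset.sum_eq_zero fun a _ =>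
        Finset.sum_eq_zero fun c _ => ?_
      have : ∀ s, fD j a (s + 1) c = (B.bAd X X ∘ₗ B.wcomp X X X (B.wpow X δ j) ∘ₗ
        B.wcomp X X X (B.letter X X f) ∘ₗ B.wcomp X X X (B.wpow X δ a) ∘ₗ
        (B.wcomp X X X).flip (B.wpow X δ c) ∘ₗ B.letter X X)
          (B.bAd X X (B.wpow X δ (s + 1))) := fun s => rfl
      simp only [this]
      rw [← map_sum, hMC, map_zero]
    refine Eq.trans ?_ h1
    refine Finset.sum_bij_ne_zero
      (fun ω _ _ => (ω.1.2, ω.2.1 - 1 - ω.1.2, ω.1.2 + 1 + ω.1.1 - ω.2.1 - ω.2.2, ω.2.2 - 1))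
      ?_ ?_ ?_ ?_
    · rintro ⟨⟨i, j⟩, r, s⟩ hω hne
      have hc := (ite_ne_right_iff.1 hne)
      have := hD _ _ _ _ hc.2
      simp only [R4, R, Finset.mem_product, Finset.mem_range]
      simp only [] at this
      omega
    · rintro ⟨⟨i, j⟩, r, s⟩ hω hne ⟨⟨i', j'⟩, r', s'⟩ hω' hne' h
      have hc := (ite_ne_right_iff.1 hne).1
      have hc' := (ite_ne_right_iff.1 hne').1
      rw [hΩ] at hω hω'
      simp only [Prod.mk.injEq] at h hc hc'
      obtain ⟨h1, h2, h3, h4⟩ := h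
      obtain rfl := h1
      obtain rfl : s = s' := by omega
      obtain rfl : r = r' := by omega
      obtain rfl : i = i' := by omega
      rfl
    · rintro ⟨j, a, c, s⟩ hx hne
      have := hD _ _ _ _ hne
      simp only [] at this
      have hmem : (⟨(a + (s + 1) + c, j), j + 1 + a, s + 1⟩ : Σ _ : ℕ × ℕ, Σ _ : ℕ, ℕ) ∈ Ω := by
        rw [hΩ]; omega
      have e1 : j + 1 + a - 1 - j = a := by omega
      have e2 : j + 1 + (a + (s + 1) + c) - (j + 1 + a) - (s + 1) = c := by omega
      refine ⟨_, hmem, ?_, ?_⟩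
      · simp only [e1, e2]
        rwa [if_pos (by omega)]
      · simp only [e1, e2, Nat.add_sub_cancel]
    · rintro ⟨⟨i, j⟩, r, s⟩ hω hne
      have hc := (ite_ne_right_iff.1 hne).1
      rw [hΩ] at hω
      rw [if_pos hc]
      simp only []
      rw [Nat.sub_add_cancel hω.2.2.1]
  have sC : ∑ ω ∈ Ω, (if ω.2.1 ≤ ω.1.2 ∧ ω.1.2 < ω.2.1 + ω.2.2 then
        fC ω.2.1 (ω.1.2 - ω.2.1) (ω.2.1 + ω.2.2 - 1 - ω.1.2)
          (ω.1.2 + 1 + ω.1.1 - ω.2.1 - ω.2.2) else 0) =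
      ∑ x ∈ R4, fC x.1 x.2.2.1 x.2.2.2 x.2.1 := by
    refine Finset.sum_bij_ne_zero
      (fun ω _ _ => (ω.2.1, ω.1.2 + 1 + ω.1.1 - ω.2.1 - ω.2.2, ω.1.2 - ω.2.1,
        ω.2.1 + ω.2.2 - 1 - ω.1.2)) ?_ ?_ ?_ ?_
    · rintro ⟨⟨i, j⟩, r, s⟩ hω hne
      have hc := (ite_ne_right_iff.1 hne)
      have := hC _ _ _ _ hc.2
      simp only [R4, R, Finset.mem_product, Finset.mem_range]
      simp only [] at this
      omega
    · rintro ⟨⟨i, j⟩, r, s⟩ hω hne ⟨⟨i', j'⟩, r', s'⟩ hω' hne' h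
      have hc := (ite_ne_right_iff.1 hne).1
      have hc' := (ite_ne_right_iff.1 hne').1
      rw [hΩ] at hω hω'
      simp only [Prod.mk.injEq] at h hc hc'
      obtain ⟨h1, h2, h3, h4⟩ := h
      obtain rfl := h1
      obtain rfl : j = j' := by omega
      obtain rfl : s = s' := by omega
      obtain rfl : i = i' := by omega
      rfl
    · rintro ⟨a, c, q, p⟩ hx hne
      have := hC _ _ _ _ hne
      simp only [] at this
      have hmem : (⟨(p + c, a + q), a, q + 1 + p⟩ : Σ _ : ℕ × ℕ, Σ _ : ℕ, ℕ) ∈ Ω := by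
        rw [hΩ]; omega
      have e1 : a + q - a = q := by omega
      have e2 : a + (q + 1 + p) - 1 - (a + q) = p := by omega
      have e3 : a + q + 1 + (p + c) - a - (q + 1 + p) = c := by omega
      refine ⟨_, hmem, ?_, ?_⟩
      · simp only [e1, e2, e3]
        rwa [if_pos (by omega)]
      · simp only [e1, e2, e3]
    · rintro ⟨⟨i, j⟩, r, s⟩ hω hne
      rw [if_pos (ite_ne_right_iff.1 hne).1]
  rw [sA, sD, sC, zero_add, sub_zero] at htot
  rw [← htot]
  simp only [R4, Finset.sum_product]
  refine Finset.sum_congr rfl fun a _ => Finset.sum_congr rfl fun c _ => ?_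
  simp only [map_sum, LinearMap.sum_apply]
  rfl

end BAlgebra

namespace TwObj

open BAlgebra

variable {X Y : TwObj.{uk, uS, uP, uZ, uX} B}

/-- The operation `b_1^{tw}` squares to zero on elements of degree `-1`.  In the direct sum `X ⊕ Y`,
with `δ = δ_X ⊕ δ_Y`, this is a statement on the words with one letter `f` and all other letters
`δ`. -/
theorem b1_b1 {f : X.Amb Y} (hf : f ∈ B.adDeg X.mod Y.mod (-1)) :
    (b1 (b1 f : X.Amb Y) : X.Amb Y) = 0 := by
  obtain ⟨N₁, hN₁⟩ := X.exists_wpow_eq_zero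
  obtain ⟨N₂, hN₂⟩ := Y.exists_wpow_eq_zero
  let N := max N₁ N₂
  have hX : B.wpow X.mod X.δ N = 0 := hN₁ _ (le_max_left _ _)
  have hY : B.wpow Y.mod Y.δ N = 0 := hN₂ _ (le_max_right _ _)
  let M := X.mod.prod Y.mod
  let i₁ := (FSMod.inl X.mod Y.mod).toLin
  let i₂ := (FSMod.inr X.mod Y.mod).toLin
  let p₁ := (FSMod.fst X.mod Y.mod).toLin
  let p₂ := (FSMod.snd X.mod Y.mod).toLin
  have p₁i₁ : p₁ ∘ₗ i₁ = LinearMap.id := FSMod.fst_inl _ _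
  have p₂i₂ : p₂ ∘ₗ i₂ = LinearMap.id := FSMod.snd_inr _ _
  have p₁i₂ : p₁ ∘ₗ i₂ = 0 := FSMod.fst_inr _ _
  have p₂i₁ : p₂ ∘ₗ i₁ = 0 := FSMod.snd_inl _ _
  have hsum : i₁ ∘ₗ p₁ + i₂ ∘ₗ p₂ = LinearMap.id := FSMod.inl_fst_add_inr_snd _ _
  let δ : B.Amb M M := post i₁ (pre p₁ X.δ) + post i₂ (pre p₂ Y.δ)
  let F : ∀ _ : X.Amb Y, B.Amb M M := fun g => post i₂ (pre p₁ g)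
  have hp₁ : (post p₁ δ : B.Amb M X.mod) = pre p₁ X.δ := by
    simp only [δ, map_add, post_post, p₁i₁, p₁i₂, post_id, post_zero_left, add_zero]
  have hi₁ : (post i₁ X.δ : B.Amb X.mod M) = pre i₁ δ := by
    simp only [δ, map_add, ← post_pre, pre_pre, p₁i₁, p₂i₁, pre_id, pre_zero_left, map_zero,
      add_zero]
  have hp₂ : (post p₂ δ : B.Amb M Y.mod) = pre p₂ Y.δ := by
    simp only [δ, map_add, post_post, p₂i₁, p₂i₂, post_id, post_zero_left, zero_add]
  have hi₂ : (post i₂ Y.δ : B.Amb Y.mod M) = pre i₂ δ := by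
    simp only [δ, map_add, ← post_pre, pre_pre, p₁i₂, p₂i₂, pre_id, pre_zero_left, map_zero,
      zero_add]
  have hsplit : ∀ n, B.wpow M δ n = post i₁ (pre p₁ (B.wpow X.mod X.δ n)) +
      post i₂ (pre p₂ (B.wpow Y.mod Y.δ n)) := by
    intro n
    rw [← post_wpow p₁ hp₁ n, ← post_wpow p₂ hp₂ n, post_post, post_post, ← post_add_left, hsum,
      post_id]
  have hδ : δ ∈ B.homDeg M M 0 :=
    add_mem (post_mem_homDeg _ (pre_mem_homDeg _ (adDeg_le_homDeg _ X.δ_mem)))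
      (post_mem_homDeg _ (pre_mem_homDeg _ (adDeg_le_homDeg _ Y.δ_mem)))
  have hF : F f ∈ B.homDeg M M (-1) := post_mem_homDeg _ (pre_mem_homDeg _ (adDeg_le_homDeg _ hf))
  have hN : B.wpow M δ N = 0 := by rw [hsplit, hX, hY]; simp
  have hMC : ∑ s ∈ Finset.range N, B.bAd M M (B.wpow M δ (s + 1)) = 0 := by
    simp only [hsplit, map_add, bAd_post, bAd_pre, Finset.sum_add_distrib]
    have h1 := congrArg (fun z => (post i₁ (pre p₁ z) : B.Amb M M)) (X.maurerCartan_sum hX)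
    have h2 := congrArg (fun z => (post i₂ (pre p₂ z) : B.Amb M M)) (Y.maurerCartan_sum hY)
    simp only [map_sum, map_zero] at h1 h2
    rw [h1, h2, add_zero]
  have hins : ∀ (g : X.Amb Y) (i j : ℕ), B.bAd M M (B.wpow M δ j ⊙
      (B.letter M M (F g) ⊙ B.wpow M δ i)) = F (B.bAd X.mod Y.mod (insWord g i j)) := by
    intro g i j
    simp only [F, insWord]
    rw [letter_post, letter_pre, wcomp_post_left, ← wcomp_pre_left, ← post_wpow i₂ hi₂,
      wcomp_pre_left, post_wpow p₁ hp₁, wcomp_pre_right, wcomp_post_left, wcomp_pre_right,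
      bAd_post, bAd_pre]
  have hFsum : ∀ g : X.Amb Y, ∑ q ∈ Finset.range N, ∑ p ∈ Finset.range N, B.bAd M M
      (B.wpow M δ q ⊙ (B.letter M M (F g) ⊙ B.wpow M δ p)) = F (b1 g) := by
    intro g
    simp only [hins, b1_eq_sum hX hY, F, map_sum]
  have key := sum_bAd_insert_insert hδ hF hN hMC
  rw [hFsum, hFsum] at key
  have hinj : ∀ g : X.Amb Y, post p₂ (pre i₁ (F g)) = g := by
    intro g
    simp only [F]
    rw [← post_pre, pre_pre, p₁i₁, pre_id, post_post, p₂i₂, post_id]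
  rw [← hinj (b1 (b1 f : X.Amb Y)), key]
  simp

end TwObj

end Square

/-! ### Kernels, cokernels and extensions of twisted modules -/

section Objects

variable {k : Type uk} {S : Type uS} {P : Type uP} [Field k] [NonUnitalRing S]
  [Module k S] {e : P → S} {B : BAlgebra.{uk, uS, uP, uZ} k e}

/-- Concatenation of words. -/
local notation:70 w " ⊙ " v:71 => BAlgebra.wcomp _ _ _ _ w v

namespace FSMod

variable {X Y : FSMod.{uk, uS, uP, uX} k e}

/-- The cokernel of a morphism of modules. -/
def coker (φ : X.Hom Y) : FSMod.{uk, uS, uP, uX} k e where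
  carrier := Y.carrier ⧸ LinearMap.range φ.toLin
  act :=
    { toFun := fun s => Submodule.mapQ _ _ (Y.act s) (by
        rintro _ ⟨x, rfl⟩
        exact ⟨X.act s x, φ.map_act s x⟩)
      map_add' := fun s t => by ext; simp
      map_smul' := fun c s => by ext; simp }
  act_mul s t x := by
    obtain ⟨y, rfl⟩ := Submodule.Quotient.mk_surjective _ x
    simp [Y.act_mul]
  top := by
    rw [eq_top_iff]
    intro x _
    obtain ⟨y, rfl⟩ := Submodule.Quotient.mk_surjective _ x
    have hy : y ∈ ⨆ u, LinearMap.range (Y.act (e u)) := by rw [Y.top]; trivial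
    induction hy using Submodule.iSup_induction' with
    | mem u y hy =>
      obtain ⟨y, rfl⟩ := hy
      exact Submodule.mem_iSup_of_mem u ⟨Submodule.Quotient.mk y, by simp⟩
    | zero => exact zero_mem _
    | add a b _ _ ha hb => exact add_mem (ha trivial) (hb trivial)
  finite_support := by
    refine Y.finite_support.subset fun u hu => ?_
    by_contra hcon
    simp only [Set.mem_ofPred_eq, not_not, LinearMap.range_eq_bot] at hcon
    refine hu (LinearMap.range_eq_bot.2 ?_)
    ext
    simp [hcon]

/-- The projection to the cokernel. -/
def cokerProj (φ : X.Hom Y) : Y.Hom (coker φ) where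
  toLin := Submodule.mkQ (LinearMap.range φ.toLin)
  map_act _ _ := rfl

theorem cokerProj_surjective (φ : X.Hom Y) : Function.Surjective (cokerProj φ).toLin :=
  Submodule.mkQ_surjective _

theorem exact_cokerProj (φ : X.Hom Y) : Function.Exact φ.toLin (cokerProj φ).toLin :=
  LinearMap.exact_map_mkQ_range _

variable [IsScalarTower k S S] [SMulCommClass k S S]

/-- The kernel of a morphism of modules. -/
def ker (hS : IsElementary k e) (ψ : X.Hom Y) : FSMod.{uk, uS, uP, uX} k e where
  carrier := LinearMap.ker ψ.toLin
  act :=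
    { toFun := fun s => (X.act s).restrict (by
        intro x hx
        rw [LinearMap.mem_ker] at hx ⊢
        rw [ψ.map_act, hx, map_zero])
      map_add' := fun s t => by ext; simp
      map_smul' := fun c s => by ext; simp }
  act_mul s t x := by
    ext
    simp [X.act_mul]
  top := by
    rw [eq_top_iff]
    intro x _
    have hx : x = ∑ u ∈ X.supp, ⟨X.act (e u) x, by
        rw [LinearMap.mem_ker, ψ.map_act, LinearMap.mem_ker.1 x.2, map_zero]⟩ := by
      ext
      simp [X.sum_act_apply hS]
    rw [hx]
    exact Submodule.sum_mem _ fun u _ => Submodule.mem_iSup_of_mem u ⟨x, rfl⟩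
  finite_support := by
    refine X.finite_support.subset fun u hu => ?_
    by_contra hcon
    simp only [Set.mem_ofPred_eq, not_not, LinearMap.range_eq_bot] at hcon
    refine hu (LinearMap.range_eq_bot.2 ?_)
    ext
    simp [hcon]

/-- The inclusion of the kernel. -/
def kerIncl (hS : IsElementary k e) (ψ : X.Hom Y) : (ker hS ψ).Hom X where
  toLin := (LinearMap.ker ψ.toLin).subtype
  map_act _ _ := rfl

theorem kerIncl_injective (hS : IsElementary k e) (ψ : X.Hom Y) :
    Function.Injective (kerIncl hS ψ).toLin :=
  Submodule.subtype_injective _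

theorem exact_kerIncl (hS : IsElementary k e) (ψ : X.Hom Y) :
    Function.Exact (kerIncl hS ψ).toLin ψ.toLin :=
  LinearMap.exact_subtype_ker_map _

end FSMod

namespace TwObj

open BAlgebra

/-- The structure of a twisted module on a quotient `Y` of `E`, when `δ_E` induces an element on
`Y`. -/
def quot (E : TwObj.{uk, uS, uP, uZ, uX} B) {Y : FSMod.{uk, uS, uP, uX} k e} (ψ : E.mod.Hom Y)
    (hψ : Function.Surjective ψ.toLin) (δ : B.Amb Y Y) (hδ : δ ∈ B.adDeg Y Y 0)
    (h : (post ψ.toLin E.δ : B.Amb E.mod Y) = pre ψ.toLin δ) :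
    TwObj.{uk, uS, uP, uZ, uX} B where
  mod := Y
  δ := δ
  δ_mem := hδ
  filtered := by
    obtain ⟨l, F, h0, hl, hF, hact, hfil⟩ := E.filtered
    refine ⟨l, fun r => (F r).map ψ.toLin, by simp [h0], ?_, fun r s hrs => Submodule.map_mono
      (hF hrs), ?_, ?_⟩
    · beta_reduce
      rw [hl, Submodule.map_top, LinearMap.range_eq_top.2 hψ]
    · rintro r s _ ⟨x, hx, rfl⟩
      exact ⟨E.mod.act s x, hact r s x hx, ψ.map_act s x⟩
    · rintro χ r hr _ ⟨x, hx, rfl⟩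
      have hc : contract χ δ ∘ₗ ψ.toLin = ψ.toLin ∘ₗ contract χ E.δ := by
        rw [← contract_pre, ← contract_post, h]
      exact ⟨contract χ E.δ x, hfil χ r hr x hx, (LinearMap.congr_fun hc x).symm⟩
  maurerCartan := by
    obtain ⟨N, hN⟩ := E.exists_wpow_eq_zero
    have hY : B.wpow Y δ N = 0 := by
      apply pre_injective (W := Y.carrier) hψ
      rw [← post_wpow ψ.toLin h, hN N le_rfl, map_zero, map_zero]
    rw [finsum_wpow hY]
    apply pre_injective (W := Y.carrier) hψ
    simp only [map_sum, ← bAd_wpow_comm ψ.toLin h]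
    rw [← map_sum, E.maurerCartan_sum (hN N le_rfl), map_zero, map_zero]

/-- The structure of a twisted module on a submodule `X` of `E`, when `δ_E` restricts to `X`. -/
def sub (E : TwObj.{uk, uS, uP, uZ, uX} B) {X : FSMod.{uk, uS, uP, uX} k e} (φ : X.Hom E.mod)
    (hφ : Function.Injective φ.toLin) (δ : B.Amb X X) (hδ : δ ∈ B.adDeg X X 0)
    (h : (post φ.toLin δ : B.Amb X E.mod) = pre φ.toLin E.δ) :
    TwObj.{uk, uS, uP, uZ, uX} B where
  mod := X
  δ := δ
  δ_mem := hδ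
  filtered := by
    obtain ⟨l, F, h0, hl, hF, hact, hfil⟩ := E.filtered
    refine ⟨l, fun r => (F r).comap φ.toLin, ?_, by simp [hl], fun r s hrs => Submodule.comap_mono
      (hF hrs), ?_, ?_⟩
    · beta_reduce
      rw [h0]
      exact LinearMap.ker_eq_bot.2 hφ
    · intro r s x hx
      rw [Submodule.mem_comap, φ.map_act]
      exact hact r s _ hx
    · intro χ r hr x hx
      have hc : φ.toLin ∘ₗ contract χ δ = contract χ E.δ ∘ₗ φ.toLin := by
        rw [← contract_pre, ← contract_post, h]
      change φ.toLin (contract χ δ x) ∈ F r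
      rw [show φ.toLin (contract χ δ x) = contract χ E.δ (φ.toLin x) from LinearMap.congr_fun hc x]
      exact hfil χ r hr _ hx
  maurerCartan := by
    obtain ⟨N, hN⟩ := E.exists_wpow_eq_zero
    have hX : B.wpow X δ N = 0 := by
      apply post_injective (U := X.carrier) hφ
      rw [post_wpow φ.toLin h, hN N le_rfl, map_zero, map_zero]
    rw [finsum_wpow hX]
    apply post_injective (U := X.carrier) hφ
    simp only [map_sum, bAd_wpow_comm φ.toLin h]
    rw [← map_sum, E.maurerCartan_sum (hN N le_rfl), map_zero, map_zero]

variable {X Y : TwObj.{uk, uS, uP, uZ, uX} B}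

/-- The element `[[δ_X, γ], [0, δ_Y]]` on `X ⊕ Y`. -/
def extδ (γ : Y.Amb X) : B.Amb (X.mod.prod Y.mod) (X.mod.prod Y.mod) :=
  post (FSMod.inl X.mod Y.mod).toLin (pre (FSMod.fst X.mod Y.mod).toLin X.δ) +
  post (FSMod.inl X.mod Y.mod).toLin (pre (FSMod.snd X.mod Y.mod).toLin γ) +
  post (FSMod.inr X.mod Y.mod).toLin (pre (FSMod.snd X.mod Y.mod).toLin Y.δ)

theorem pre_inl_extδ (γ : Y.Amb X) :
    (pre (FSMod.inl X.mod Y.mod).toLin (extδ γ) : B.Amb X.mod (X.mod.prod Y.mod)) =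
      post (FSMod.inl X.mod Y.mod).toLin X.δ := by
  simp [extδ, ← post_pre, pre_pre, FSMod.fst_inl, FSMod.snd_inl]

theorem pre_inr_extδ (γ : Y.Amb X) :
    (pre (FSMod.inr X.mod Y.mod).toLin (extδ γ) : B.Amb Y.mod (X.mod.prod Y.mod)) =
      post (FSMod.inl X.mod Y.mod).toLin γ + post (FSMod.inr X.mod Y.mod).toLin Y.δ := by
  simp [extδ, ← post_pre, pre_pre, FSMod.fst_inr, FSMod.snd_inr]

theorem post_fst_extδ (γ : Y.Amb X) :
    (post (FSMod.fst X.mod Y.mod).toLin (extδ γ) : B.Amb (X.mod.prod Y.mod) X.mod) =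
      pre (FSMod.fst X.mod Y.mod).toLin X.δ + pre (FSMod.snd X.mod Y.mod).toLin γ := by
  simp [extδ, post_post, FSMod.fst_inl, FSMod.fst_inr]

theorem post_snd_extδ (γ : Y.Amb X) :
    (post (FSMod.snd X.mod Y.mod).toLin (extδ γ) : B.Amb (X.mod.prod Y.mod) Y.mod) =
      pre (FSMod.snd X.mod Y.mod).toLin Y.δ := by
  simp [extδ, post_post, FSMod.snd_inl, FSMod.snd_inr]

/-- A sum over a square, arranged by antidiagonals. -/
theorem sum_range_sum_antidiagonal {V : Type*} [AddCommMonoid V] {N : ℕ} {g : ℕ × ℕ → V}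
    (hg : ∀ i, g i ≠ 0 → i.1 < N ∧ i.2 < N) :
    ∑ n ∈ Finset.range (2 * N), ∑ i ∈ Finset.HasAntidiagonal.antidiagonal n, g i =
      ∑ i ∈ Finset.range N, ∑ j ∈ Finset.range N, g (i, j) := by
  rw [← Finset.sum_product', Finset.sum_sigma']
  refine Finset.sum_bij_ne_zero (fun x _ _ => x.2) ?_ ?_ ?_ ?_
  · rintro ⟨n, i⟩ _ hne
    simpa using hg i hne
  · rintro ⟨n, i⟩ h1 _ ⟨m, j⟩ h2 _ h
    simp only [Finset.mem_sigma, Finset.HasAntidiagonal.mem_antidiagonal] at h1 h2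
    simp only at h
    obtain rfl := h
    obtain rfl : n = m := h1.2.symm.trans h2.2
    rfl
  · rintro i hi hne
    have := hg i hne
    refine ⟨⟨i.1 + i.2, i⟩, ?_, hne, rfl⟩
    simp only [Finset.mem_sigma, Finset.mem_range, Finset.HasAntidiagonal.mem_antidiagonal,
      and_true]
    omega
  · rintro ⟨n, i⟩ _ _
    rfl

/-- The entry of the powers of `[[δ_X, γ], [0, δ_Y]]` above the diagonal. -/
theorem post_fst_pre_inr_wpow_extδ (γ : Y.Amb X) (n : ℕ) :
    (post (FSMod.fst X.mod Y.mod).toLin (pre (FSMod.inr X.mod Y.mod).toLin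
      (B.wpow (X.mod.prod Y.mod) (extδ γ) (n + 1))) : B.Word Y.mod X.mod) =
      ∑ i ∈ Finset.HasAntidiagonal.antidiagonal n, insWord γ i.2 i.1 := by
  have hs : ∀ n, (post (FSMod.snd X.mod Y.mod).toLin (pre (FSMod.inr X.mod Y.mod).toLin
      (B.wpow (X.mod.prod Y.mod) (extδ γ) n)) : B.Word Y.mod Y.mod) = B.wpow Y.mod Y.δ n := by
    intro n
    rw [post_pre, post_wpow _ (post_snd_extδ γ), pre_pre, FSMod.snd_inr, pre_id]
  have hstep : ∀ n, (post (FSMod.fst X.mod Y.mod).toLin (pre (FSMod.inr X.mod Y.mod).toLin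
      (B.wpow (X.mod.prod Y.mod) (extδ γ) (n + 1))) : B.Word Y.mod X.mod) =
      B.letter X.mod X.mod X.δ ⊙ post (FSMod.fst X.mod Y.mod).toLin
        (pre (FSMod.inr X.mod Y.mod).toLin (B.wpow (X.mod.prod Y.mod) (extδ γ) n)) +
      B.letter Y.mod X.mod γ ⊙ B.wpow Y.mod Y.δ n := by
    intro n
    rw [wpow_succ, ← wcomp_pre_right, ← wcomp_post_left, ← letter_post, post_fst_extδ, map_add,
      map_add, LinearMap.add_apply, letter_pre, letter_pre, wcomp_pre_left, wcomp_pre_left, hs]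
  induction n with
  | zero =>
    rw [hstep, wpow_zero, Finset.HasAntidiagonal.antidiagonal_zero, Finset.sum_singleton,
      insWord, wpow_zero, wpow_zero, one_wcomp]
    simp [FSMod.fst_inr]
  | succ n ih =>
    rw [hstep, ih, Finset.Nat.sum_antidiagonal_succ, map_sum, add_comm]
    congr 1
    · rw [insWord, wpow_zero, one_wcomp]
    · refine Finset.sum_congr rfl fun i _ => ?_
      rw [insWord, insWord, wpow_succ, wcomp_assoc]

theorem extδ_filtered (γ : Y.Amb X) :
    ∃ (l : ℕ) (F : ℕ → Submodule k (X.mod.prod Y.mod).carrier),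
      F 0 = ⊥ ∧ F l = ⊤ ∧ Monotone F ∧ (∀ r s, ∀ x ∈ F r, (X.mod.prod Y.mod).act s x ∈ F r) ∧
      ∀ (φ : B.carrier →ₗ[k] k) (r : ℕ), r < l → ∀ x ∈ F (r + 1), contract φ (extδ γ) x ∈ F r := by
  obtain ⟨l, F, h0, hl, hF, hact, hfil⟩ := X.filtered
  obtain ⟨l', F', h0', hl', hF', hact', hfil'⟩ := Y.filtered
  -- first the filtration of `X`, then the preimages of the steps of the filtration of `Y`
  refine ⟨l + l', fun r => (F r).prod (F' (r - l)), ?_, ?_, ?_, ?_, ?_⟩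
  · beta_reduce
    rw [h0, Nat.zero_sub, h0']
    exact Submodule.prod_bot
  · beta_reduce
    have : F (l + l') = ⊤ := top_unique (hl ▸ hF (Nat.le_add_right l l'))
    rw [this, Nat.add_sub_cancel_left, hl']
    exact Submodule.prod_top
  · exact fun r s hrs => Submodule.prod_mono (hF hrs) (hF' (by omega))
  · rintro r s ⟨x, y⟩ ⟨hx, hy⟩
    exact ⟨hact r s x hx, hact' _ s y hy⟩
  · rintro χ r hr ⟨x, y⟩ ⟨hx, hy⟩
    have hc : contract χ (extδ γ) (x, y) =
        (contract χ X.δ x + contract χ γ y, contract χ Y.δ y) := by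
      simp only [extδ, map_add, contract_post, contract_pre]
      refine Prod.ext ?_ ?_
      · change contract χ X.δ x + contract χ γ y + 0 = _
        rw [add_zero]
      · change (0 : Y.mod.carrier) + 0 + contract χ Y.δ y = _
        rw [add_zero, zero_add]
    rw [hc]
    rcases lt_or_ge r l with h | h
    · have hy0 : y = 0 := by
        have e0 : r + 1 - l = 0 := by omega
        have hy' : y ∈ F' (r + 1 - l) := hy
        rw [e0, h0'] at hy'
        simpa using hy'
      subst hy0
      rw [map_zero, map_zero, add_zero]
      exact ⟨hfil χ r h x hx, zero_mem _⟩
    · refine ⟨?_, ?_⟩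
      · have : F r = ⊤ := top_unique (hl ▸ hF h)
        rw [this]
        trivial
      · have e1 : r + 1 - l = r - l + 1 := by omega
        have hy' : y ∈ F' (r + 1 - l) := hy
        rw [e1] at hy'
        exact hfil' χ (r - l) (by omega) y hy'

/-- The Maurer-Cartan equation for `[[δ_X, γ], [0, δ_Y]]` says that `γ` is a `b_1^{tw}`-cycle. -/
theorem extδ_maurerCartan {γ : Y.Amb X} (hb : (b1 γ : Y.Amb X) = 0) :
    ∑ᶠ s : ℕ, B.bAd (X.mod.prod Y.mod) (X.mod.prod Y.mod)
      (B.wpow (X.mod.prod Y.mod) (extδ γ) (s + 1)) = 0 := by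
  obtain ⟨N₁, hN₁⟩ := X.exists_wpow_eq_zero
  obtain ⟨N₂, hN₂⟩ := Y.exists_wpow_eq_zero
  obtain ⟨l, F, h0, hl, hF, _, hfil⟩ := extδ_filtered γ
  let N := max (max N₁ N₂) l
  have hX : ∀ n, N ≤ n → B.wpow X.mod X.δ n = 0 := fun n hn => hN₁ n (by omega)
  have hY : ∀ n, N ≤ n → B.wpow Y.mod Y.δ n = 0 := fun n hn => hN₂ n (by omega)
  have hE : B.wpow (X.mod.prod Y.mod) (extδ γ) (2 * N) = 0 :=
    wpow_eq_zero_of_le (wpow_eq_zero_of_filtered h0 hl hF hfil) (by omega)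
  rw [finsum_wpow hE]
  set m := ∑ s ∈ Finset.range (2 * N), B.bAd (X.mod.prod Y.mod) (X.mod.prod Y.mod)
      (B.wpow (X.mod.prod Y.mod) (extδ γ) (s + 1)) with hm
  have h1 : (pre (FSMod.inl X.mod Y.mod).toLin m : B.Amb X.mod (X.mod.prod Y.mod)) = 0 := by
    simp only [hm, map_sum, ← bAd_wpow_comm _ (pre_inl_extδ γ).symm]
    rw [← map_sum, X.maurerCartan_sum (hX _ (by omega)), map_zero]
  have h2 : (post (FSMod.snd X.mod Y.mod).toLin m : B.Amb (X.mod.prod Y.mod) Y.mod) = 0 := by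
    simp only [hm, map_sum, bAd_wpow_comm _ (post_snd_extδ γ)]
    rw [← map_sum, Y.maurerCartan_sum (hY _ (by omega)), map_zero]
  have h3 : (post (FSMod.fst X.mod Y.mod).toLin (pre (FSMod.inr X.mod Y.mod).toLin m) :
      B.Amb Y.mod X.mod) = 0 := by
    simp only [hm, map_sum, ← bAd_pre, ← bAd_post, post_fst_pre_inr_wpow_extδ]
    rw [sum_range_sum_antidiagonal (N := N) (g := fun i => B.bAd Y.mod X.mod (insWord γ i.2 i.1)),
      ← b1_eq_sum (hY N le_rfl) (hX N le_rfl), hb]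
    intro i hi
    by_contra hcon
    refine hi ?_
    rw [not_and_or, not_lt, not_lt] at hcon
    rcases hcon with h | h
    · simp [insWord, hX _ h]
    · simp [insWord, hY _ h]
  calc m = post (FSMod.inl X.mod Y.mod).toLin (post (FSMod.fst X.mod Y.mod).toLin m) := by
        conv_lhs => rw [← post_id m, ← FSMod.inl_fst_add_inr_snd, post_add_left, ← post_post,
          ← post_post, h2, map_zero, add_zero]
    _ = 0 := by
        rw [← pre_id m, ← FSMod.inl_fst_add_inr_snd, pre_add_left, ← pre_pre, ← pre_pre, h1,
          map_zero, zero_add, post_pre, h3, map_zero, map_zero]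

/-- The extension of `Y` by `X` defined by a `b_1^{tw}`-cycle `γ` of degree `0`: the twisted module
`X ⊕ Y` with `δ = [[δ_X, γ], [0, δ_Y]]`. -/
def extension (γ : Y.Amb X) (hγ : γ ∈ B.adDeg Y.mod X.mod 0) (hb : (b1 γ : Y.Amb X) = 0) :
    TwObj.{uk, uS, uP, uZ, uX} B where
  mod := X.mod.prod Y.mod
  δ := extδ γ
  δ_mem := add_mem (add_mem (post_mem_adDeg _ (pre_mem_adDeg _ X.δ_mem))
    (post_mem_adDeg _ (pre_mem_adDeg _ hγ))) (post_mem_adDeg _ (pre_mem_adDeg _ Y.δ_mem))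
  filtered := extδ_filtered γ
  maurerCartan := extδ_maurerCartan hb

/-- The inclusion of `X` into an extension of `Y` by `X`. -/
def extInl (γ : Y.Amb X) (hγ : γ ∈ B.adDeg Y.mod X.mod 0) (hb : (b1 γ : Y.Amb X) = 0) :
    X.mod.Hom (extension γ hγ hb).mod :=
  FSMod.inl X.mod Y.mod

/-- The inclusion of `Y` into an extension of `Y` by `X`, which need not commute with the
`δ`'s. -/
def extInr (γ : Y.Amb X) (hγ : γ ∈ B.adDeg Y.mod X.mod 0) (hb : (b1 γ : Y.Amb X) = 0) :
    Y.mod.Hom (extension γ hγ hb).mod :=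
  FSMod.inr X.mod Y.mod

/-- The projection of an extension of `Y` by `X` to `X`, which need not commute with the
`δ`'s. -/
def extFst (γ : Y.Amb X) (hγ : γ ∈ B.adDeg Y.mod X.mod 0) (hb : (b1 γ : Y.Amb X) = 0) :
    (extension γ hγ hb).mod.Hom X.mod :=
  FSMod.fst X.mod Y.mod

/-- The projection of an extension of `Y` by `X` to `Y`. -/
def extSnd (γ : Y.Amb X) (hγ : γ ∈ B.adDeg Y.mod X.mod 0) (hb : (b1 γ : Y.Amb X) = 0) :
    (extension γ hγ hb).mod.Hom Y.mod :=
  FSMod.snd X.mod Y.mod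

variable {γ : Y.Amb X} (hγ : γ ∈ B.adDeg Y.mod X.mod 0) (hb : (b1 γ : Y.Amb X) = 0)

theorem pre_extInl : (pre (extInl γ hγ hb).toLin (extension γ hγ hb).δ :
    X.Amb (extension γ hγ hb)) = post (extInl γ hγ hb).toLin X.δ :=
  pre_inl_extδ γ

theorem pre_extInr : (pre (extInr γ hγ hb).toLin (extension γ hγ hb).δ :
    Y.Amb (extension γ hγ hb)) =
      post (extInl γ hγ hb).toLin γ + post (extInr γ hγ hb).toLin Y.δ :=
  pre_inr_extδ γ

theorem post_extFst : (post (extFst γ hγ hb).toLin (extension γ hγ hb).δ :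
    (extension γ hγ hb).Amb X) =
      pre (extFst γ hγ hb).toLin X.δ + pre (extSnd γ hγ hb).toLin γ :=
  post_fst_extδ γ

theorem post_extSnd : (post (extSnd γ hγ hb).toLin (extension γ hγ hb).δ :
    (extension γ hγ hb).Amb Y) = pre (extSnd γ hγ hb).toLin Y.δ :=
  post_snd_extδ γ

end TwObj

end Objects

/-! ### Special conflations -/

section Conflations

variable {k : Type uk} {S : Type uS} {P : Type uP} [Field k] [NonUnitalRing S]
  [Module k S] {e : P → S} {B : BAlgebra.{uk, uS, uP, uZ} k e} {unit : P → B.carrier}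

namespace TwObj

open BAlgebra

variable {X E Y W : TwObj.{uk, uS, uP, uZ, uX} B}

theorem lift_eq_zero {φ : X.mod.Hom Y.mod} (h : φ.toLin = 0) :
    (lift unit φ : X.Amb Y) = 0 := by
  simp [lift_eq_sum, h]

theorem comp_intertwines {ψ : Y.mod.Hom W.mod} {φ : X.mod.Hom Y.mod}
    (hψ : (post ψ.toLin Y.δ : Y.Amb W) = pre ψ.toLin W.δ)
    (hφ : (post φ.toLin X.δ : X.Amb Y) = pre φ.toLin Y.δ) :
    (post (ψ.comp φ).toLin X.δ : X.Amb W) = pre (ψ.comp φ).toLin W.δ := by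
  rw [FSMod.Hom.comp_toLin, ← post_post, ← pre_pre, hφ, ← hψ, post_pre]

variable [IsScalarTower k S S] [SMulCommClass k S S]

/-- A special conflation is a short exact sequence of modules whose maps commute with the `δ`'s. -/
theorem isSpecialConflation_iff (hS : IsElementary k e) (hunit : B.IsStrictUnits unit)
    (f : X.Amb E) (g : E.Amb Y) : IsSpecialConflation unit f g ↔
      ∃ (φ : X.mod.Hom E.mod) (ψ : E.mod.Hom Y.mod), f = lift unit φ ∧ g = lift unit ψ ∧
        (post φ.toLin X.δ : X.Amb E) = pre φ.toLin E.δ ∧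
        (post ψ.toLin E.δ : E.Amb Y) = pre ψ.toLin Y.δ ∧
        Function.Injective φ.toLin ∧ Function.Exact φ.toLin ψ.toLin ∧
        Function.Surjective ψ.toLin := by
  constructor
  · rintro ⟨hf, hg, φ, ψ, rfl, rfl, h⟩
    exact ⟨φ, ψ, rfl, rfl, (isMor_lift_iff hS hunit φ).1 hf, (isMor_lift_iff hS hunit ψ).1 hg,
      (φ.injective_iff_res hS).2 fun u => (h u).1, (φ.exact_iff_res hS ψ).2 fun u => (h u).2.1,
      (ψ.surjective_iff_res hS).2 fun u => (h u).2.2⟩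
  · rintro ⟨φ, ψ, rfl, rfl, h1, h2, hi, he, hs⟩
    exact ⟨(isMor_lift_iff hS hunit φ).2 h1, (isMor_lift_iff hS hunit ψ).2 h2, φ, ψ, rfl, rfl,
      fun u => ⟨(φ.injective_iff_res hS).1 hi u, (φ.exact_iff_res hS ψ).1 he u,
        (ψ.surjective_iff_res hS).1 hs u⟩⟩

/-- An injective morphism of modules that commutes with the `δ`'s is a special inflation: `δ_E`
induces a structure of twisted module on its cokernel. -/
theorem isSpecialInflation_iff (hS : IsElementary k e) (hunit : B.IsStrictUnits unit)
    (f : X.Amb E) : IsSpecialInflation unit f ↔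
      ∃ φ : X.mod.Hom E.mod, f = lift unit φ ∧
        (post φ.toLin X.δ : X.Amb E) = pre φ.toLin E.δ ∧ Function.Injective φ.toLin := by
  constructor
  · rintro ⟨Y, g, h⟩
    obtain ⟨φ, ψ, hf, -, h1, -, hi, -⟩ := (isSpecialConflation_iff hS hunit f g).1 h
    exact ⟨φ, hf, h1, hi⟩
  · rintro ⟨φ, rfl, h1, hi⟩
    let ψ := FSMod.cokerProj φ
    have hs := FSMod.cokerProj_surjective φ
    have he := FSMod.exact_cokerProj φ
    obtain ⟨r, σ, hr, hσ, hrσ⟩ := φ.exists_splitting hS ψ hi he hs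
    have hψφ : ψ.toLin ∘ₗ φ.toLin = 0 := he.linearMap_comp_eq_zero
    let δ : B.Amb (FSMod.coker φ) (FSMod.coker φ) := post ψ.toLin (pre σ.toLin E.δ)
    have hδ : (post ψ.toLin E.δ : B.Amb E.mod (FSMod.coker φ)) = pre ψ.toLin δ := by
      conv_lhs => rw [← pre_id E.δ, ← hrσ, pre_add_left, map_add, ← pre_pre, ← pre_pre, ← h1,
        post_pre, post_post, hψφ, post_zero_left, map_zero, zero_add, post_pre]
    exact ⟨E.quot ψ hs δ (post_mem_adDeg _ (pre_mem_adDeg _ E.δ_mem)) hδ, _,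
      (isSpecialConflation_iff hS hunit _ _).2 ⟨φ, ψ, rfl, rfl, h1, hδ, hi, he, hs⟩⟩

/-- A surjective morphism of modules that commutes with the `δ`'s is a special deflation: `δ_E`
restricts to its kernel. -/
theorem isSpecialDeflation_iff (hS : IsElementary k e) (hunit : B.IsStrictUnits unit)
    (g : E.Amb Y) : IsSpecialDeflation unit g ↔
      ∃ ψ : E.mod.Hom Y.mod, g = lift unit ψ ∧
        (post ψ.toLin E.δ : E.Amb Y) = pre ψ.toLin Y.δ ∧ Function.Surjective ψ.toLin := by
  constructor
  · rintro ⟨X, f, h⟩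
    obtain ⟨φ, ψ, -, hg, -, h2, -, -, hs⟩ := (isSpecialConflation_iff hS hunit f g).1 h
    exact ⟨ψ, hg, h2, hs⟩
  · rintro ⟨ψ, rfl, h2, hs⟩
    let φ := FSMod.kerIncl hS ψ
    have hi := FSMod.kerIncl_injective hS ψ
    have he := FSMod.exact_kerIncl hS ψ
    obtain ⟨r, σ, hr, hσ, hrσ⟩ := φ.exists_splitting hS ψ hi he hs
    have hψφ : ψ.toLin ∘ₗ φ.toLin = 0 := he.linearMap_comp_eq_zero
    let δ : B.Amb (FSMod.ker hS ψ) (FSMod.ker hS ψ) := post r.toLin (pre φ.toLin E.δ)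
    have hδ : (post φ.toLin δ : B.Amb (FSMod.ker hS ψ) E.mod) = pre φ.toLin E.δ := by
      conv_rhs => rw [← post_id E.δ, ← hrσ, post_add_left, map_add, ← post_post, ← post_post, h2,
        ← post_pre, ← post_pre, ← post_pre, pre_pre, hψφ, pre_zero_left, map_zero, add_zero]
    exact ⟨E.sub φ hi δ (post_mem_adDeg _ (pre_mem_adDeg _ E.δ_mem)) hδ, _,
      (isSpecialConflation_iff hS hunit _ _).2 ⟨φ, ψ, rfl, rfl, hδ, h2, hi, he, hs⟩⟩

theorem star_lift_lift (hS : IsElementary k e) (hunit : B.IsStrictUnits unit)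
    (ψ : Y.mod.Hom W.mod) (φ : X.mod.Hom Y.mod) :
    star (lift unit ψ : Y.Amb W) (lift unit φ : X.Amb Y) = (lift unit (ψ.comp φ) : X.Amb W) := by
  rw [star_lift_left hS hunit ψ (lift_mem_adDeg hS hunit φ), post_lift]

theorem isKernel_of_isSpecialConflation (hS : IsElementary k e) (hunit : B.IsStrictUnits unit)
    {f : X.Amb E} {g : E.Amb Y} (h : IsSpecialConflation unit f g) : IsKernel f g := by
  obtain ⟨φ, ψ, rfl, rfl, h1, h2, hi, he, hs⟩ := (isSpecialConflation_iff hS hunit f g).1 h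
  obtain ⟨r, σ, hr, hσ, hrσ⟩ := φ.exists_splitting hS ψ hi he hs
  refine ⟨?_, fun W h hh hgh => ?_⟩
  · rw [star_lift_lift hS hunit]
    exact lift_eq_zero he.linearMap_comp_eq_zero
  · rw [star_lift_left hS hunit ψ hh.1] at hgh
    have hφr : post φ.toLin (post r.toLin h) = h := by
      conv_rhs => rw [← post_id h, ← hrσ, post_add_left, ← post_post, ← post_post, hgh, map_zero,
        add_zero]
    refine ⟨post r.toLin h, ⟨⟨post_mem_adDeg r hh.1, ?_⟩, ?_⟩, ?_⟩
    · apply post_injective (U := W.mod.carrier) hi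
      rw [← b1_post φ.toLin h1, hφr, hh.2, map_zero]
    · rw [star_lift_left hS hunit φ (post_mem_adDeg r hh.1), hφr]
    · rintro h' ⟨hh', hfh'⟩
      rw [star_lift_left hS hunit φ hh'.1] at hfh'
      apply post_injective (U := W.mod.carrier) hi
      rw [hfh', hφr]

theorem isCokernel_of_isSpecialConflation (hS : IsElementary k e) (hunit : B.IsStrictUnits unit)
    {f : X.Amb E} {g : E.Amb Y} (h : IsSpecialConflation unit f g) : IsCokernel f g := by
  obtain ⟨φ, ψ, rfl, rfl, h1, h2, hi, he, hs⟩ := (isSpecialConflation_iff hS hunit f g).1 h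
  obtain ⟨r, σ, hr, hσ, hrσ⟩ := φ.exists_splitting hS ψ hi he hs
  refine ⟨?_, fun W h hh hgh => ?_⟩
  · rw [star_lift_lift hS hunit]
    exact lift_eq_zero he.linearMap_comp_eq_zero
  · rw [star_lift_right hS hunit φ hh.1] at hgh
    have hσψ : pre ψ.toLin (pre σ.toLin h) = h := by
      conv_rhs => rw [← pre_id h, ← hrσ, pre_add_left, ← pre_pre, ← pre_pre, hgh, map_zero,
        zero_add]
    refine ⟨pre σ.toLin h, ⟨⟨pre_mem_adDeg σ hh.1, ?_⟩, ?_⟩, ?_⟩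
    · apply pre_injective (W := W.mod.carrier) hs
      rw [← b1_pre ψ.toLin h2, hσψ, hh.2, map_zero]
    · rw [star_lift_right hS hunit ψ (pre_mem_adDeg σ hh.1), hσψ]
    · rintro h' ⟨hh', hfh'⟩
      rw [star_lift_right hS hunit ψ hh'.1] at hfh'
      apply pre_injective (W := W.mod.carrier) hs
      rw [hfh', hσψ]

/-- A cycle `γ` from `Y` to `X` such that `γ ψ` is the boundary of `t` extends `t` to a morphism
from `E` to the extension of `Y` by `X` that `γ` defines. -/
theorem isMor_to_extension (hS : IsElementary k e) (hunit : B.IsStrictUnits unit)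
    {γ : Y.Amb X} (hγm : γ ∈ B.adDeg Y.mod X.mod 0) (hγ : (b1 γ : Y.Amb X) = 0)
    {ψ : E.mod.Hom Y.mod} (hψ : (post ψ.toLin E.δ : E.Amb Y) = pre ψ.toLin Y.δ) {t : E.Amb X}
    (ht : t ∈ B.adDeg E.mod X.mod (-1)) (hb : (b1 t : E.Amb X) = pre ψ.toLin γ) :
    IsMor (post (extInl γ hγm hγ).toLin t + lift unit ((extInr γ hγm hγ).comp ψ) :
      E.Amb (extension γ hγm hγ)) := by
  refine ⟨add_mem (post_mem_adDeg _ ht) (lift_mem_adDeg hS hunit _), ?_⟩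
  have hl : (b1 (lift unit ((extInr γ hγm hγ).comp ψ) : E.Amb (extension γ hγm hγ)) :
      E.Amb (extension γ hγm hγ)) = -post (extInl γ hγm hγ).toLin (pre ψ.toLin γ) := by
    rw [b1_lift hS hunit, FSMod.Hom.comp_toLin, ← post_post, ← pre_pre, pre_extInr, hψ, map_add,
      ← post_pre, ← post_pre]
    abel
  rw [b1_add, b1_post _ (pre_extInl hγm hγ).symm, hl, hb]
  exact add_neg_cancel _

/-- A cycle `γ` from `Y` to `X` such that `-φ γ` is the boundary of `t` extends `t` to a morphism
to `E` from the extension of `Y` by `X` that `γ` defines. -/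
theorem isMor_from_extension (hS : IsElementary k e) (hunit : B.IsStrictUnits unit)
    {γ : Y.Amb X} (hγm : γ ∈ B.adDeg Y.mod X.mod 0) (hγ : (b1 γ : Y.Amb X) = 0)
    {φ : X.mod.Hom E.mod} (hφ : (post φ.toLin X.δ : X.Amb E) = pre φ.toLin E.δ) {t : Y.Amb E}
    (ht : t ∈ B.adDeg Y.mod E.mod (-1)) (hb : (b1 t : Y.Amb E) = -post φ.toLin γ) :
    IsMor (pre (extSnd γ hγm hγ).toLin t + lift unit (φ.comp (extFst γ hγm hγ)) :
      (extension γ hγm hγ).Amb E) := by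
  refine ⟨add_mem (pre_mem_adDeg _ ht) (lift_mem_adDeg hS hunit _), ?_⟩
  have hl : (b1 (lift unit (φ.comp (extFst γ hγm hγ)) : (extension γ hγm hγ).Amb E) :
      (extension γ hγm hγ).Amb E) = pre (extSnd γ hγm hγ).toLin (post φ.toLin γ) := by
    rw [b1_lift hS hunit, FSMod.Hom.comp_toLin, ← post_post, ← pre_pre, post_extFst, ← hφ, map_add,
      post_pre, post_pre]
    abel
  rw [b1_add, b1_pre _ (post_extSnd hγm hγ), hl, hb, map_neg]
  exact neg_add_cancel _

/-- The pushout of a special inflation `X → E` with cokernel `Y` along `h : X → X'`: with a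
retraction `r` of `X → E`, the cycle `b_1^{tw}(h r)` factors through `Y`, and the pushout is the
extension of `Y` by `X'` that it defines. -/
theorem exists_pushout (hS : IsElementary k e) (hunit : B.IsStrictUnits unit)
    {X' : TwObj.{uk, uS, uP, uZ, uX} B} {f : X.Amb E} {h : X.Amb X'}
    (hf : IsSpecialInflation unit f) (hh : IsMor h) :
    ∃ (E' : TwObj.{uk, uS, uP, uZ, uX} B) (f' : X'.Amb E') (h' : E.Amb E'),
      IsSpecialInflation unit f' ∧ IsMor h' ∧ star h' f = star f' h := by
  obtain ⟨Y, g, hfg⟩ := hf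
  obtain ⟨φ, ψ, rfl, rfl, h1, h2, hi, he, hs⟩ := (isSpecialConflation_iff hS hunit f g).1 hfg
  obtain ⟨r, σ, hr, -, hrσ⟩ := φ.exists_splitting hS ψ hi he hs
  obtain ⟨t, ht, htφ⟩ : ∃ t : E.Amb X', t ∈ B.adDeg E.mod X'.mod (-1) ∧
      (pre φ.toLin t : X.Amb X') = h :=
    ⟨pre r.toLin h, pre_mem_adDeg r hh.1, by rw [pre_pre, hr, pre_id]⟩
  obtain ⟨γ, hγm, htγ⟩ : ∃ γ : Y.Amb X', γ ∈ B.adDeg Y.mod X'.mod 0 ∧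
      (b1 t : E.Amb X') = pre ψ.toLin γ := by
    refine ⟨pre σ.toLin (b1 t : E.Amb X'),
      pre_mem_adDeg σ (b1_mem_adDeg hS (neg_add_cancel 1) ht), ?_⟩
    conv_lhs => rw [← pre_id (b1 t : E.Amb X'), ← hrσ, pre_add_left, ← pre_pre, ← pre_pre,
      ← b1_pre φ.toLin h1, htφ, hh.2, map_zero, zero_add]
  have hγ : (b1 γ : Y.Amb X') = 0 := by
    apply pre_injective (W := X'.mod.carrier) hs
    rw [← b1_pre ψ.toLin h2, ← htγ, b1_b1 ht, map_zero]
  have hmor := isMor_to_extension hS hunit hγm hγ h2 ht htγ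
  refine ⟨extension γ hγm hγ, lift unit (extInl γ hγm hγ), _, (isSpecialInflation_iff hS hunit _).2
    ⟨_, rfl, (pre_extInl hγm hγ).symm, LinearMap.inl_injective⟩, hmor, ?_⟩
  rw [star_lift_right hS hunit φ hmor.1, star_lift_left hS hunit _ hh.1, map_add, ← post_pre, htφ,
    pre_lift, lift_eq_zero, add_zero]
  rw [FSMod.Hom.comp_toLin, FSMod.Hom.comp_toLin, LinearMap.comp_assoc, he.linearMap_comp_eq_zero,
    LinearMap.comp_zero]

/-- The pullback of a special deflation `E → Y` with kernel `X` along `h : Y' → Y`: with a section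
`σ` of `E → Y`, the cycle `-b_1^{tw}(σ h)` factors through `X`, and the pullback is the extension of
`Y'` by `X` that it defines. -/
theorem exists_pullback (hS : IsElementary k e) (hunit : B.IsStrictUnits unit)
    {Y' : TwObj.{uk, uS, uP, uZ, uX} B} {g : E.Amb Y} {h : Y'.Amb Y}
    (hg : IsSpecialDeflation unit g) (hh : IsMor h) :
    ∃ (E' : TwObj.{uk, uS, uP, uZ, uX} B) (g' : E'.Amb Y') (h' : E'.Amb E),
      IsSpecialDeflation unit g' ∧ IsMor h' ∧ star g h' = star h g' := by
  obtain ⟨X, f, hfg⟩ := hg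
  obtain ⟨φ, ψ, rfl, rfl, h1, h2, hi, he, hs⟩ := (isSpecialConflation_iff hS hunit f g).1 hfg
  obtain ⟨r, σ, -, hσ, hrσ⟩ := φ.exists_splitting hS ψ hi he hs
  obtain ⟨t, ht, htψ⟩ : ∃ t : Y'.Amb E, t ∈ B.adDeg Y'.mod E.mod (-1) ∧
      (post ψ.toLin t : Y'.Amb Y) = h :=
    ⟨post σ.toLin h, post_mem_adDeg σ hh.1, by rw [post_post, hσ, post_id]⟩
  obtain ⟨γ, hγm, htγ⟩ : ∃ γ : Y'.Amb X, γ ∈ B.adDeg Y'.mod X.mod 0 ∧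
      (b1 t : Y'.Amb E) = -post φ.toLin γ := by
    refine ⟨-post r.toLin (b1 t : Y'.Amb E),
      neg_mem (post_mem_adDeg r (b1_mem_adDeg hS (neg_add_cancel 1) ht)), ?_⟩
    conv_lhs => rw [← post_id (b1 t : Y'.Amb E), ← hrσ, post_add_left, ← post_post, ← post_post,
      ← b1_post ψ.toLin h2, htψ, hh.2, map_zero, add_zero]
    rw [map_neg, neg_neg]
  have hγ : (b1 γ : Y'.Amb X) = 0 := by
    apply post_injective (U := Y'.mod.carrier) hi
    rw [← b1_post φ.toLin h1, map_zero, ← neg_eq_zero, ← b1_neg, ← htγ, b1_b1 ht]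
  have hmor := isMor_from_extension hS hunit hγm hγ h1 ht htγ
  refine ⟨extension γ hγm hγ, lift unit (extSnd γ hγm hγ), _, (isSpecialDeflation_iff hS hunit _).2
    ⟨_, rfl, post_extSnd hγm hγ, LinearMap.snd_surjective⟩, hmor, ?_⟩
  rw [star_lift_left hS hunit ψ hmor.1, star_lift_right hS hunit _ hh.1, map_add, post_pre, htψ,
    post_lift, lift_eq_zero, add_zero]
  rw [FSMod.Hom.comp_toLin, FSMod.Hom.comp_toLin, ← LinearMap.comp_assoc,
    he.linearMap_comp_eq_zero, LinearMap.zero_comp]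

end TwObj

end Conflations

end SpecialConflations

end

open SpecialConflations in
theorem mainTheorem5 {k : Type uk} {S : Type uS} {P : Type uP} [Field k] [NonUnitalRing S] [Module k S]
    [IsScalarTower k S S] [SMulCommClass k S S] {e : P → S} (hS : IsElementary k e)
    (B : BAlgebra.{uk, uS, uP, uZ} k e) (T : Translation B.toGradedBimodule) (hT : T.IsBNuAlgebra)
    (unit : P → B.carrier) (hunit : B.IsStrictUnits unit) :
    (∀ (X E Y : TwObj.{uk, uS, uP, uZ, uX} B) (f : X.Amb E) (g : E.Amb Y),
      TwObj.IsSpecialConflation unit f g → TwObj.IsKernel f g ∧ TwObj.IsCokernel f g) ∧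
    ((∀ (X E W : TwObj.{uk, uS, uP, uZ, uX} B) (f : X.Amb E) (g : E.Amb W),
      TwObj.IsSpecialInflation unit f → TwObj.IsSpecialInflation unit g →
        TwObj.IsSpecialInflation unit (TwObj.star g f)) ∧
     (∀ (X E W : TwObj.{uk, uS, uP, uZ, uX} B) (f : X.Amb E) (g : E.Amb W),
      TwObj.IsSpecialDeflation unit f → TwObj.IsSpecialDeflation unit g →
        TwObj.IsSpecialDeflation unit (TwObj.star g f))) ∧
    (∀ (X E X' : TwObj.{uk, uS, uP, uZ, uX} B) (f : X.Amb E) (h : X.Amb X'),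
      TwObj.IsSpecialInflation unit f → TwObj.IsMor h →
        ∃ (E' : TwObj.{uk, uS, uP, uZ, uX} B) (f' : X'.Amb E') (h' : E.Amb E'),
          TwObj.IsSpecialInflation unit f' ∧ TwObj.IsMor h' ∧
            TwObj.star h' f = TwObj.star f' h) ∧
    (∀ (E Y Y' : TwObj.{uk, uS, uP, uZ, uX} B) (g : E.Amb Y) (h : Y'.Amb Y),
      TwObj.IsSpecialDeflation unit g → TwObj.IsMor h →
        ∃ (E' : TwObj.{uk, uS, uP, uZ, uX} B) (g' : E'.Amb Y') (h' : E'.Amb E),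
          TwObj.IsSpecialDeflation unit g' ∧ TwObj.IsMor h' ∧
            TwObj.star g h' = TwObj.star h g') ∧
    ((∀ X : TwObj B, TwObj.IsSpecialInflation unit (TwObj.one unit X) ∧
      TwObj.IsSpecialDeflation unit (TwObj.one unit X)) ∧
     (∀ (X E W : TwObj.{uk, uS, uP, uZ, uX} B) (f : X.Amb E) (g : E.Amb W),
      TwObj.IsSpecial unit f → TwObj.IsSpecial unit g →
        (TwObj.IsSpecialInflation unit (TwObj.star g f) → TwObj.IsSpecialInflation unit f) ∧
        (TwObj.IsSpecialDeflation unit (TwObj.star g f) → TwObj.IsSpecialDeflation unit g))) := by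

  refine ⟨fun X E Y f g h => ⟨TwObj.isKernel_of_isSpecialConflation hS hunit h,
    TwObj.isCokernel_of_isSpecialConflation hS hunit h⟩, ⟨?_, ?_⟩,
    fun X E X' f h hf hh => TwObj.exists_pushout hS hunit hf hh,
    fun E Y Y' g h hg hh => TwObj.exists_pullback hS hunit hg hh, fun X => ⟨?_, ?_⟩, ?_⟩
  · intro X E W f g hf hg
    obtain ⟨φ, rfl, hφ, hφi⟩ := (TwObj.isSpecialInflation_iff hS hunit f).1 hf
    obtain ⟨ψ, rfl, hψ, hψi⟩ := (TwObj.isSpecialInflation_iff hS hunit g).1 hg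
    exact (TwObj.isSpecialInflation_iff hS hunit _).2 ⟨ψ.comp φ,
      TwObj.star_lift_lift hS hunit ψ φ, TwObj.comp_intertwines hψ hφ, hψi.comp hφi⟩
  · intro X E W f g hf hg
    obtain ⟨φ, rfl, hφ, hφs⟩ := (TwObj.isSpecialDeflation_iff hS hunit f).1 hf
    obtain ⟨ψ, rfl, hψ, hψs⟩ := (TwObj.isSpecialDeflation_iff hS hunit g).1 hg
    exact (TwObj.isSpecialDeflation_iff hS hunit _).2 ⟨ψ.comp φ,
      TwObj.star_lift_lift hS hunit ψ φ, TwObj.comp_intertwines hψ hφ, hψs.comp hφs⟩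
  · exact (TwObj.isSpecialInflation_iff hS hunit _).2 ⟨X.mod.idHom, rfl,
      (post_id X.δ).trans (pre_id X.δ).symm, Function.injective_id⟩
  · exact (TwObj.isSpecialDeflation_iff hS hunit _).2 ⟨X.mod.idHom, rfl,
      (post_id X.δ).trans (pre_id X.δ).symm, Function.surjective_id⟩
  · rintro X E W _ _ ⟨hf, φ, rfl⟩ ⟨hg, ψ, rfl⟩
    rw [TwObj.star_lift_lift hS hunit]
    constructor
    · intro h
      obtain ⟨χ, hχ, -, hi⟩ := (TwObj.isSpecialInflation_iff hS hunit _).1 h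
      obtain rfl := TwObj.lift_injective hS hunit hχ
      exact (TwObj.isSpecialInflation_iff hS hunit _).2 ⟨φ, rfl,
        (TwObj.isMor_lift_iff hS hunit φ).1 hf, Function.Injective.of_comp hi⟩
    · intro h
      obtain ⟨χ, hχ, -, hs⟩ := (TwObj.isSpecialDeflation_iff hS hunit _).1 h
      obtain rfl := TwObj.lift_injective hS hunit hχ
      exact (TwObj.isSpecialDeflation_iff hS hunit _).2 ⟨ψ, rfl,
        (TwObj.isMor_lift_iff hS hunit ψ).1 hg, Function.Surjective.of_comp hs⟩
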